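/- Let $G=(V,E,w)$ be a finite simple undirected graph with finite nonnegative edge weights (unweighted graphs being the case $w\equiv 1$), and let $\mathrm{dist}_G$ be its shortest-path distance, with value $\infty$ between different components. For a graph $H=(V,E_H)$ on the same vertex set (not necessarily a subgraph of $G$), $H$ is a *$t$-emulator* of $G$ if, when each edge $\{a,b\}\in E_H$ is given weight $\mathrm{dist}_G(a,b)$, $$\mathrm{dist}_G(u,v)\le \mathrm{dist}_H(u,v)\le t\cdot \mathrm{dist}_G(u,v)\qquad\text{for all }u,v\in V .$$ $H$ is an *$f$-edge-fault-tolerant ($f$-EFT) $t$-emulator* of $G$ if for every $F\subseteq E$ with $|F|\le f$, $H$ is a $t$-emulator of $G\setminus F$ (so the edges of $H$ are unchanged, but are reweighted by $\mathrm{dist}_{G\setminus F}$). 1. For every constant $C$ there is a constant $K$, depending only on $C$, such that for every $n$, every $n$-node weighted graph $G$ and every integer $f\ge 0$ with $f\le C n^{2/9}$, there is an $f$-EFT $5$-emulator $H$ of $G$ with $|E(H)|\le K n^{4/3}$. 2. For every odd positive integer $k$ and every constant $C$ there is a constant $K$, depending only on $k$ and $C$, such that for every $n$, every $n$-node weighted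 graph $G$ and every integer $f\ge 0$ with $f\le C n^{2/(k(k+1))}$, there is an $f$-EFT $(2k-1)$-emulator $H$ of $G$ with $|E(H)|\le K n^{1+1/k}$. -/

import Mathlib

open scoped NNReal ENNReal

universe u

namespace EFT

/-- Total weight of a walk, where `w e` is the weight of the edge `e`. -/
noncomputable def walkWeight {V : Type u} {G : SimpleGraph V} (w : Sym2 V → ℝ≥0∞) {a b : V}
    (p : G.Walk a b) : ℝ≥0∞ :=
  (p.edges.map w).sum

/-- Shortest-path distance from `a` to `b` in the graph `G` with edge weights `w`; it is `∞` when
`b` is not reachable from `a`. Only the values of `w` on edges of `G` matter. -/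
noncomputable def wdist {V : Type u} (G : SimpleGraph V) (w : Sym2 V → ℝ≥0∞) (a b : V) : ℝ≥0∞ :=
  ⨅ p : G.Walk a b, walkWeight w p

theorem wdist_comm {V : Type u} (G : SimpleGraph V) (w : Sym2 V → ℝ≥0∞) (a b : V) :
    wdist G w a b = wdist G w b a := by
  have h : ∀ x y : V, wdist G w x y ≤ wdist G w y x := fun x y =>
    le_iInf fun p => (iInf_le _ p.reverse).trans (le_of_eq (by
      simp [walkWeight, SimpleGraph.Walk.edges_reverse, List.map_reverse, List.sum_reverse]))
  exact le_antisymm (h a b) (h b a)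

/-- The weight function of an emulator of `(G, w)`: the pair `{a, b}` has weight
`dist_G(a, b)`. -/
noncomputable def emulatorWeight {V : Type u} (G : SimpleGraph V) (w : Sym2 V → ℝ≥0∞) :
    Sym2 V → ℝ≥0∞ :=
  Sym2.lift ⟨wdist G w, wdist_comm G w⟩

/-- `H` is a `t`-emulator of the weighted graph `(G, w)`: when each edge `{a, b}` of `H` gets
weight `dist_G(a, b)`, one has `dist_G(a, b) ≤ dist_H(a, b) ≤ t * dist_G(a, b)` for all vertices
`a, b`. The graph `H` need not be a subgraph of `G`. -/
def IsEmulator {V : Type u} (G : SimpleGraph V) (w : Sym2 V → ℝ≥0∞) (t : ℝ≥0)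
    (H : SimpleGraph V) : Prop :=
  ∀ a b : V, wdist G w a b ≤ wdist H (emulatorWeight G w) a b ∧
    wdist H (emulatorWeight G w) a b ≤ (t : ℝ≥0∞) * wdist G w a b

/-- `H` is an `f`-edge-fault-tolerant `t`-emulator of the graph `G` with finite nonnegative edge
weights `w`: for every set `F` of at most `f` edges of `G`, `H` is a `t`-emulator of `G \ F`. The
edge set of `H` is not changed by the faults; only its weights are. -/
def IsEFTEmulator {V : Type u} (G : SimpleGraph V) (w : Sym2 V → ℝ≥0) (f : ℕ) (t : ℝ≥0)
    (H : SimpleGraph V) : Prop :=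
  ∀ F : Finset (Sym2 V), (F : Set (Sym2 V)) ⊆ G.edgeSet → F.card ≤ f →
    IsEmulator (G.deleteEdges (F : Set (Sym2 V))) (fun e => (w e : ℝ≥0∞)) t H

end EFT

/-!
Scan the edges of `G` by increasing weight and keep `xy` exactly if, for some set `F` of at most `f`
faults, the edges kept so far, reweighted by `dist_{G \ F}`, do not connect `x` and `y` within `t`
times the weight of `xy`, where `t = 2k - 1`. The result `H` is a fault-tolerant emulator, and each
kept edge remembers its faults: every path of length at most `t` from `x` to `y` along lighter edges
of `H` contains a fault, since non-faulty edges do not get longer. A path of length at most `k`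
contains even two faults: the ends of a single fault are still joined in `G \ F` by the rest of the
path and the edge `xy`, that is, by at most `k` edges not heavier than `xy`, which gives a detour of
at most `(k - 1) + k = t` such edges.

Let `k = 2r + 1` and let `d` be the average degree of `H`, which becomes about the maximum degree
once vertices of large degree are split. Dropping the `δ ≈ d / r` lightest edges at every vertex,
`r` times over, leaves most edges. A remaining edge `e` has at each end about `d ^ r` arms with
distinct far ends: walks of length `r` along edges lighter than `e` of decreasing rank, without
faults of `e` and without mutual faults. The ends are distinct because two arms that meet would
close up to a short cycle in which the heaviest edge sees at most one fault. If `e` and a lighter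
edge `e'` have the same pair of far ends, then `e'` and the four arms make a detour of length
`4r + 1 = t` for `e`, which must contain a fault of `e`. Hence such collisions happen near faults
only and are negligible unless `d ^ 2 = O((f + 1) ^ k)`. If they are negligible, the `n * d` edges
have about `d ^ (2r)` pairs of far ends each, almost all distinct, among `n ^ 2` possible pairs, so
that `d ^ k = O(n)`.
-/

namespace EFT

section FiniteSets

variable {α : Type*}

theorem card_filter_few_below_le {S : Finset α} {rk : α → ℕ} (hrk : Set.InjOn rk S) (δ : ℕ) :
    {g ∈ S | {h ∈ S | rk h < rk g}.card < δ}.card ≤ δ := by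
  classical
  by_contra! hlt
  obtain ⟨g, hg, hmax⟩ := Finset.exists_max_image _ rk (Finset.card_pos.1 (Nat.zero_lt_of_lt hlt))
  have hbelow : {g ∈ S | {h ∈ S | rk h < rk g}.card < δ}.erase g ⊆ {h ∈ S | rk h < rk g} := by
    intro h hh
    obtain ⟨hne, hh⟩ := Finset.mem_erase.1 hh
    have hS : h ∈ S := (Finset.mem_filter.1 hh).1
    exact Finset.mem_filter.2 ⟨hS, lt_of_le_of_ne (hmax h hh) fun heq =>
      hne (hrk hS (Finset.mem_filter.1 hg).1 heq)⟩
  have hcard := Finset.card_le_card hbelow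
  rw [Finset.card_erase_of_mem hg] at hcard
  have := (Finset.mem_filter.1 hg).2
  omega

theorem exists_hittingSet (𝒜 : Finset (Finset α)) {s n : ℕ} (hempty : ∅ ∉ 𝒜)
    (hs : ∀ A ∈ 𝒜, A.card ≤ s)
    (hn : ∀ ℬ ⊆ 𝒜, (ℬ : Set (Finset α)).PairwiseDisjoint id → ℬ.card ≤ n) :
    ∃ T : Finset α, T.card ≤ n * s ∧ ∀ A ∈ 𝒜, ¬ Disjoint A T := by
  classical
  obtain ⟨ℬ, hℬ, hmax⟩ :=
    (𝒜.powerset.filter fun ℬ : Finset (Finset α) =>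
      (ℬ : Set (Finset α)).PairwiseDisjoint id).exists_maximal ⟨∅, by simp⟩
  obtain ⟨hsub, hdisj⟩ : ℬ ⊆ 𝒜 ∧ (ℬ : Set (Finset α)).PairwiseDisjoint id := by simpa using hℬ
  refine ⟨ℬ.biUnion id, (Finset.card_biUnion_le_card_mul _ _ s fun A hA => hs A (hsub hA)).trans
    (Nat.mul_le_mul_right s (hn ℬ hsub hdisj)), fun A hA hAT => hempty ?_⟩
  have hAB : ∀ B ∈ ℬ, Disjoint A B := fun B hB =>
    hAT.mono_right (Finset.subset_biUnion_of_mem id hB)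
  have hins : insert A ℬ ⊆ ℬ := by
    refine hmax (Finset.mem_filter.2 ⟨?_, ?_⟩) (Finset.subset_insert A ℬ)
    · exact Finset.mem_powerset.2 (Finset.insert_subset hA hsub)
    · rw [Finset.coe_insert]
      exact hdisj.insert fun B hB _ => hAB B hB
  have hself := hAB A (hins (Finset.mem_insert_self A ℬ))
  rwa [← Finset.bot_eq_empty, ← disjoint_self.1 hself]

theorem exists_mem_disjoint_of_card_lt {ℬ : Finset (Finset α)} {F : Finset α}
    (hℬ : (ℬ : Set (Finset α)).PairwiseDisjoint id) (hF : F.card < ℬ.card) :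
    ∃ A ∈ ℬ, Disjoint A F := by
  classical
  by_contra! hcon
  have hcard : ℬ.card ≤ (ℬ.biUnion (· ∩ F)).card :=
    Finset.card_le_card_biUnion (fun A hA B hB hAB =>
      (hℬ hA hB hAB).mono Finset.inter_subset_left Finset.inter_subset_left)
      fun A hA => Finset.not_disjoint_iff_nonempty_inter.1 (hcon A hA)
  have hsub : ℬ.biUnion (· ∩ F) ⊆ F := Finset.biUnion_subset.2 fun _ _ => Finset.inter_subset_right
  exact absurd hF (not_lt.2 (hcard.trans (Finset.card_le_card hsub)))

theorem exists_partition_card_le (S : Finset α) {Δ : ℕ} (hΔ : 0 < Δ) :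
    ∃ k, k * Δ ≤ Δ + S.card ∧ ∃ part : α → Fin k, ∀ i, {x ∈ S | part x = i}.card ≤ Δ := by
  classical
  obtain ⟨rk, hrk, hlt⟩ : ∃ rk : α → ℕ, Set.InjOn rk S ∧ ∀ x, rk x ≤ S.card := by
    refine ⟨fun x => if h : x ∈ S then S.equivFin ⟨x, h⟩ else 0, fun x hx y hy hxy => ?_,
      fun x => ?_⟩
    · simpa [Finset.mem_coe.1 hx, Finset.mem_coe.1 hy, Fin.val_inj] using hxy
    · dsimp only
      split_ifs with h
      exacts [(S.equivFin ⟨x, h⟩).is_lt.le, Nat.zero_le _]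
  refine ⟨S.card / Δ + 1, ?_,
    fun x => ⟨rk x / Δ, Nat.lt_succ_of_le (Nat.div_le_div_right (hlt x))⟩, fun i => ?_⟩
  · rw [add_one_mul, add_comm]
    exact Nat.add_le_add_left (Nat.div_mul_le_self _ _) _
  calc _ ≤ (Finset.Ico (i * Δ) ((i + 1) * Δ)).card := by
        refine Finset.card_le_card_of_injOn rk (fun x hx => ?_)
          (hrk.mono fun x hx => (Finset.mem_filter.1 hx).1)
        have hxi : rk x / Δ = i := congrArg Fin.val (Finset.mem_filter.1 hx).2
        rw [Finset.coe_Ico, Set.mem_Ico, ← hxi, ← Nat.div_lt_iff_lt_mul hΔ]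
        exact ⟨Nat.div_mul_le_self _ _, Nat.lt_succ_self _⟩
    _ = Δ := by rw [Nat.card_Ico, ← Nat.sub_mul, Nat.add_sub_cancel_left, one_mul]

theorem exists_injective_rank {β : Type*} [Finite α] [LinearOrder β] (w : α → β) :
    ∃ rank : α → ℕ, Function.Injective rank ∧ ∀ x y, rank x ≤ rank y → w x ≤ w y := by
  have := Fintype.ofFinite α
  let e := Fintype.equivFin α
  let σ := Tuple.sort (w ∘ e.symm)
  refine ⟨fun x => σ.symm (e x), fun x y hxy => by simpa [Fin.val_inj] using hxy,
    fun x y hxy => ?_⟩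
  simpa [σ] using Tuple.monotone_sort (w ∘ e.symm) (Fin.le_def.2 hxy)

theorem exists_greedy_selection (rk : α → ℕ) (P : Set α → α → Prop) :
    ∃ S : Set α, ∀ e, e ∈ S ↔ P {g ∈ S | rk g < rk e} e := by
  let step (e : α) (ih : ∀ g, rk g < rk e → Prop) : Prop := P {g | ∃ h : rk g < rk e, ih g h} e
  refine ⟨{e | (measure rk).wf.fix step e}, fun e => ?_⟩
  rw [Set.mem_ofPred_eq, WellFounded.fix_eq]
  simp only [step, Set.mem_ofPred_eq, exists_prop, and_comm]

end FiniteSets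

section Walks

variable {V : Type u} {X : SimpleGraph V}

theorem exists_eq_append_cons_of_mem_edges {a b : V} {p : X.Walk a b} {g : Sym2 V}
    (hg : g ∈ p.edges) : ∃ (x y : V) (q : X.Walk a x) (h : X.Adj x y) (q' : X.Walk y b),
      g = s(x, y) ∧ p = q.append (q'.cons h) := by
  induction p with
  | nil => simp at hg
  | @cons a x b h p ih =>
    rcases List.mem_cons.1 hg with rfl | hg
    · exact ⟨a, x, .nil, h, p, rfl, rfl⟩
    · obtain ⟨y, z, q, h', q', rfl, rfl⟩ := ih hg
      exact ⟨y, z, q.cons h, h', q', rfl, rfl⟩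

theorem exists_eq_append_cons_of_notMem_of_mem {a b : V} (p : X.Walk a b) {Z : Set V} (ha : a ∉ Z)
    (hb : b ∈ Z) : ∃ (x y : V) (q : X.Walk a x) (h : X.Adj x y) (q' : X.Walk y b),
      x ∉ Z ∧ y ∈ Z ∧ p = q.append (q'.cons h) := by
  induction p with
  | nil => exact absurd hb ha
  | @cons a x b h p ih =>
    by_cases hx : x ∈ Z
    · exact ⟨a, x, .nil, h, p, ha, hx, rfl⟩
    · obtain ⟨y, z, q, h', q', hy, hz, rfl⟩ := ih hx hb
      exact ⟨y, z, q.cons h, h', q', hy, hz, rfl⟩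

theorem exists_walk_avoiding_edge {a b : V} {p : X.Walk a b} (hp : p.IsTrail) {e : Sym2 V}
    (he : e ∈ p.edges) (q : X.Walk a b) :
    ∃ (x y : V) (d : X.Walk x y), e = s(x, y) ∧ d.length + 1 = p.length + q.length ∧
      ∀ g ∈ d.edges, g ∈ q.edges ∨ g ∈ p.edges ∧ g ≠ e := by
  obtain ⟨x, y, p₁, h, p₂, rfl, rfl⟩ := exists_eq_append_cons_of_mem_edges he
  refine ⟨x, y, p₁.reverse.append (q.append p₂.reverse), rfl, ?_, fun g hg => ?_⟩
  · simp only [SimpleGraph.Walk.length_append, SimpleGraph.Walk.length_reverse,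
      SimpleGraph.Walk.length_cons]
    omega
  · replace hp := hp.edges_nodup
    simp only [SimpleGraph.Walk.edges_append, SimpleGraph.Walk.edges_cons,
      SimpleGraph.Walk.edges_reverse, List.mem_append, List.mem_reverse, List.mem_cons,
      List.nodup_append, List.nodup_cons] at hg hp ⊢
    grind

end Walks

/-! ### Blocking systems -/

/-- A ranking of the edges of `X` together with, for every edge `e`, a set of at most `f` faults of
`e`, such that the faults of `xy` block the short detours from `x` to `y` along lighter edges:
those of length at most `t` contain a fault, those of length at most `(t + 1) / 2` contain two. It
records what is needed of the fault sets that force the greedy algorithm to keep its edges. -/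
structure BlockingSystem {V : Type u} (X : SimpleGraph V) (t f : ℕ) where
  rank : Sym2 V → ℕ
  rank_injOn : Set.InjOn rank X.edgeSet
  faults : Sym2 V → Finset (Sym2 V)
  card_faults_le : ∀ e, (faults e).card ≤ f
  notMem_faults : ∀ e, e ∉ faults e
  exists_mem_faults : ∀ {x y}, X.Adj x y → ∀ p : X.Walk x y,
    (∀ g ∈ p.edges, rank g < rank s(x, y)) → p.length ≤ t → ∃ g ∈ p.edges, g ∈ faults s(x, y)
  nontrivial_faults : ∀ {x y}, X.Adj x y → ∀ p : X.Walk x y,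
    (∀ g ∈ p.edges, rank g < rank s(x, y)) → 2 * p.length ≤ t + 1 →
      {g | g ∈ p.edges ∧ g ∈ faults s(x, y)}.Nontrivial

namespace BlockingSystem

variable {V : Type u} {X : SimpleGraph V} {t f : ℕ} (c : BlockingSystem X t f)

/-- Two edges are related if both belong to the cluster `{e} ∪ faults e` of some edge `e`. -/
def Rel (g h : Sym2 V) : Prop :=
  ∃ e ∈ X.edgeSet, (g = e ∨ g ∈ c.faults e) ∧ (h = e ∨ h ∈ c.faults e)

/-- A list of edges is clean if their ranks decrease and no two of them are related. -/
def Clean (l : List (Sym2 V)) : Prop :=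
  l.Pairwise fun g h => c.rank h < c.rank g ∧ ¬ c.Rel g h

/-- A list of edges is tame if it contains at most one fault of each of its members. -/
def Tame (l : List (Sym2 V)) : Prop :=
  ∀ e ∈ l, {g | g ∈ l ∧ g ∈ c.faults e}.Subsingleton

variable {c}

theorem Rel.symm {g h : Sym2 V} : c.Rel g h → c.Rel h g :=
  fun ⟨e, he, hg, hh⟩ => ⟨e, he, hh, hg⟩

theorem Clean.nodup {l : List (Sym2 V)} (hl : c.Clean l) : l.Nodup :=
  hl.imp fun h heq => (heq ▸ h.1).false

theorem Clean.not_rel {l : List (Sym2 V)} (hl : c.Clean l) {g h : Sym2 V} (hg : g ∈ l)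
    (hh : h ∈ l) (hgh : g ≠ h) : ¬ c.Rel g h :=
  have : Std.Symm fun g h => ¬ c.Rel g h := ⟨fun _ _ hn hr => hn hr.symm⟩
  (hl.imp And.right).forall hg hh hgh

theorem Clean.tame_cons {l l' : List (Sym2 V)} (hl' : c.Clean l') (hE : ∀ g ∈ l', g ∈ X.edgeSet)
    (hl : l ⊆ l') {g : Sym2 V} (hg : g ∈ X.edgeSet) : c.Tame (g :: l) := by
  have hfault : ∀ {e h}, e ∈ l → h ∈ l → h ∉ c.faults e := fun {e h} he hh hf =>
    hl'.not_rel (hl hh) (hl he) (fun heq => c.notMem_faults e (heq ▸ hf))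
      ⟨e, hE e (hl he), Or.inr hf, Or.inl rfl⟩
  have hself : ∀ {e h}, e ∈ g :: l → h ∈ l → h ∈ c.faults e → e = g := fun he hh hf =>
    (List.mem_cons.1 he).resolve_right fun he => hfault he hh hf
  rintro e he h ⟨hh, hhF⟩ h' ⟨hh', hhF'⟩
  rcases List.mem_cons.1 hh with rfl | hhl <;> rcases List.mem_cons.1 hh' with rfl | hhl'
  · rfl
  · exact absurd (hself he hhl' hhF' ▸ hhF) (c.notMem_faults _)
  · exact absurd (hself he hhl hhF ▸ hhF') (c.notMem_faults _)
  · obtain rfl := hself he hhl hhF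
    by_contra hne
    exact hl'.not_rel (hl hhl) (hl hhl') hne ⟨e, hg, Or.inr hhF, Or.inr hhF'⟩

theorem Clean.not_rank_lt {a x y s : V} {hx : X.Adj a x} {p : X.Walk x s} {hy : X.Adj a y}
    {q : X.Walk y s} (hp : c.Clean (p.cons hx).edges) (hq : c.Clean (q.cons hy).edges)
    (hlen : 2 * (p.length + q.length + 1) ≤ t + 1) : ¬ c.rank s(a, y) < c.rank s(a, x) := by
  intro hlt
  have hp' := List.pairwise_cons.1 hp
  have hq' := List.pairwise_cons.1 hq
  have hmem : ∀ g, g ∈ ((q.cons hy).append p.reverse).edges ↔ g ∈ (q.cons hy).edges ∨ g ∈ p.edges :=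
    fun g => by simp [or_assoc]
  obtain ⟨g, ⟨hg, hgF⟩, h, ⟨hh, hhF⟩, hgh⟩ := c.nontrivial_faults hx ((q.cons hy).append p.reverse)
    (fun g hg => by
      rcases (hmem g).1 hg with hg | hg
      · rcases List.mem_cons.1 hg with rfl | hg
        exacts [hlt, (hq'.1 g hg).1.trans hlt]
      · exact (hp'.1 g hg).1)
    (by simp only [SimpleGraph.Walk.length_append, SimpleGraph.Walk.length_cons,
      SimpleGraph.Walk.length_reverse]; omega)
  have hfault : ∀ g ∈ ((q.cons hy).append p.reverse).edges, g ∈ c.faults s(a, x) →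
      g ∈ (q.cons hy).edges := fun g hg hgF => ((hmem g).1 hg).resolve_right fun hgp =>
    (hp'.1 g hgp).2 ⟨s(a, x), hx, Or.inl rfl, Or.inr hgF⟩
  exact hq.not_rel (hfault g hg hgF) (hfault h hh hhF) hgh ⟨_, hx, Or.inr hgF, Or.inr hhF⟩

theorem Clean.walk_ext {a s : V} {p q : X.Walk a s} (hp : c.Clean p.edges) (hq : c.Clean q.edges)
    (hpq : p.length = q.length) (hlen : 4 * p.length ≤ t + 3) : p = q := by
  induction p with
  | nil => exact (SimpleGraph.Walk.eq_nil_iff_nil.2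
      (SimpleGraph.Walk.length_eq_zero_iff.1 hpq.symm)).symm
  | @cons a x s hx p ih =>
    cases q with
    | nil => cases hpq
    | @cons _ y _ hy q =>
      simp only [SimpleGraph.Walk.length_cons, Nat.add_right_cancel_iff] at hpq hlen
      have hrank : c.rank s(a, x) = c.rank s(a, y) :=
        le_antisymm (not_lt.1 (hp.not_rank_lt hq (by omega)))
          (not_lt.1 (hq.not_rank_lt hp (by omega)))
      obtain rfl := Sym2.congr_right.1 (c.rank_injOn hx hy hrank)
      rw [ih (List.pairwise_cons.1 hp).2 (List.pairwise_cons.1 hq).2 hpq (by omega)]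

theorem Tame.exists_mem_faults {a b : V} {p q : X.Walk a b} (htame : c.Tame p.edges)
    (htrail : p.IsTrail) {e : Sym2 V} (he : e ∈ p.edges)
    (hp : ∀ g ∈ p.edges, c.rank g ≤ c.rank e) (hq : ∀ g ∈ q.edges, c.rank g < c.rank e)
    (hlen : 2 * (p.length + q.length) ≤ t + 3) : ∃ g ∈ q.edges, g ∈ c.faults e := by
  by_contra! hqF
  have hpE : ∀ g ∈ p.edges, g ∈ X.edgeSet := fun g hg => p.edges_subset_edgeSet hg
  obtain ⟨x, y, d, rfl, hdlen, hd⟩ := exists_walk_avoiding_edge htrail he q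
  have hdlight : ∀ g ∈ d.edges, c.rank g < c.rank s(x, y) := by
    intro g hg
    rcases hd g hg with hg | ⟨hg, hne⟩
    · exact hq g hg
    · exact (hp g hg).lt_of_ne fun heq => hne (c.rank_injOn (hpE g hg) (hpE _ he) heq)
  obtain ⟨g, ⟨hg, hgF⟩, h, ⟨hh, hhF⟩, hgh⟩ := c.nontrivial_faults (hpE _ he) d hdlight (by omega)
  have hmem_p : ∀ g ∈ d.edges, g ∈ c.faults s(x, y) → g ∈ p.edges := fun g hg hgF =>
    ((hd g hg).resolve_left fun hgq => hqF g hgq hgF).1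
  exact hgh (htame _ he ⟨hmem_p g hg hgF, hgF⟩ ⟨hmem_p h hh hhF, hhF⟩)

theorem card_le_of_pairwiseDisjoint_of_tame {a b : V} {l : ℕ} (hl : 4 * l ≤ t + 3)
    {ℬ : Finset (Finset (Sym2 V))} (hℬ : (ℬ : Set (Finset (Sym2 V))).PairwiseDisjoint id)
    (hwalk : ∀ A ∈ ℬ, A.Nonempty ∧ ∃ p : X.Walk a b, (∀ g, g ∈ A ↔ g ∈ p.edges) ∧ p.length ≤ l ∧
      p.IsTrail ∧ c.Tame p.edges) : ℬ.card ≤ f + 1 := by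
  classical
  by_contra! hcard
  obtain ⟨A₀, hA₀⟩ := Finset.card_pos.1 (Nat.zero_lt_of_lt hcard)
  obtain ⟨g₀, hg₀⟩ := (hwalk A₀ hA₀).1
  obtain ⟨e, he, hmax⟩ := (ℬ.biUnion id).exists_max_image c.rank
    ⟨g₀, Finset.mem_biUnion.2 ⟨A₀, hA₀, hg₀⟩⟩
  replace hmax : ∀ A ∈ ℬ, ∀ g ∈ A, c.rank g ≤ c.rank e := fun A hA g hg =>
    hmax g (Finset.mem_biUnion.2 ⟨A, hA, hg⟩)
  obtain ⟨A, hA, heA⟩ := Finset.mem_biUnion.1 he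
  obtain ⟨-, p, hpA, hpl, htrail, htame⟩ := hwalk A hA
  obtain ⟨B, hB, hBF⟩ := exists_mem_disjoint_of_card_lt (ℬ := ℬ.erase A) (F := c.faults e)
    (hℬ.subset (Finset.coe_subset.2 (Finset.erase_subset A ℬ)))
    (by have := c.card_faults_le e; rw [Finset.card_erase_of_mem hA]; omega)
  obtain ⟨hBA, hB⟩ := Finset.mem_erase.1 hB
  obtain ⟨-, q, hqB, hql, -⟩ := hwalk B hB
  have hq : ∀ g ∈ q.edges, c.rank g < c.rank e := fun g hg =>
    (hmax B hB g ((hqB g).2 hg)).lt_of_ne fun heq =>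
      Finset.disjoint_left.1 (hℬ hB hA hBA) ((hqB g).2 hg)
        (c.rank_injOn (q.edges_subset_edgeSet hg)
          (p.edges_subset_edgeSet ((hpA e).1 heA)) heq ▸ heA)
  obtain ⟨g, hg, hgF⟩ := htame.exists_mem_faults htrail ((hpA e).1 heA)
    (fun g hg => hmax A hA g ((hpA g).2 hg)) hq (by omega)
  exact Finset.disjoint_left.1 hBF ((hqB g).2 hg) hgF

theorem Tame.mono {l l' : List (Sym2 V)} (hl' : c.Tame l') (hl : l ⊆ l') : c.Tame l :=
  fun e he => (hl' e (hl he)).anti fun _ hg => ⟨hl hg.1, hg.2⟩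

theorem exists_edges_meeting_tame_trails [Finite V] (c : BlockingSystem X t f)
    (a b : V) {l : ℕ} (hl : 4 * l ≤ t + 3) :
    ∃ T : Finset (Sym2 V), T.card ≤ (f + 1) * l ∧ ∀ p : X.Walk a b, p.edges ≠ [] → p.length ≤ l →
      p.IsTrail → c.Tame p.edges → ∃ g ∈ p.edges, g ∈ T := by
  classical
  have := Fintype.ofFinite V
  let 𝒜 : Finset (Finset (Sym2 V)) := {A | A.Nonempty ∧ ∃ p : X.Walk a b,
    (∀ g, g ∈ A ↔ g ∈ p.edges) ∧ p.length ≤ l ∧ p.IsTrail ∧ c.Tame p.edges}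
  have hcard : ∀ A ∈ 𝒜, A.card ≤ l := by
    intro A hA
    obtain ⟨-, -, p, hp, hlen, -⟩ := Finset.mem_filter.1 hA
    have hAp : A ⊆ p.edges.toFinset := fun g hg => List.mem_toFinset.2 ((hp g).1 hg)
    calc A.card ≤ p.edges.toFinset.card := Finset.card_le_card hAp
      _ ≤ p.edges.length := p.edges.toFinset_card_le
      _ ≤ l := p.length_edges ▸ hlen
  obtain ⟨T, hT, hmeet⟩ := exists_hittingSet 𝒜 (by simp [𝒜]) hcard fun ℬ hsub hℬ =>
    card_le_of_pairwiseDisjoint_of_tame hl hℬ fun A hA => (Finset.mem_filter.1 (hsub hA)).2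
  refine ⟨T, hT, fun p hne hlen htrail htame => ?_⟩
  have hA := hmeet p.edges.toFinset (Finset.mem_filter.2 ⟨Finset.mem_univ _,
    List.toFinset_nonempty_iff _ |>.2 hne, p, fun g => List.mem_toFinset, hlen, htrail, htame⟩)
  obtain ⟨g, hg, hgT⟩ := Finset.not_disjoint_iff.1 hA
  exact ⟨g, List.mem_toFinset.1 hg, hgT⟩

end BlockingSystem

section Ball

variable {V : Type u} [Fintype V] {X : SimpleGraph V}

open Classical in
/-- The vertices that can be reached from `a` by a walk of length at most `l`. -/
noncomputable def ball (X : SimpleGraph V) (l : ℕ) (a : V) : Finset V :=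
  {b | ∃ p : X.Walk a b, p.length ≤ l}

theorem mem_ball {l : ℕ} {a b : V} : b ∈ ball X l a ↔ ∃ p : X.Walk a b, p.length ≤ l := by
  simp only [ball, Finset.mem_filter, Finset.mem_univ, true_and]

theorem card_ball_le {Δ : ℕ} (hΔ : ∀ v, (X.neighborSet v).ncard < Δ) (l : ℕ) (a : V) :
    (ball X l a).card ≤ Δ ^ l := by
  classical
  induction l generalizing a with
  | zero =>
    refine Finset.card_le_one.2 fun b hb b' hb' => ?_
    obtain ⟨p, hp⟩ := mem_ball.1 hb
    obtain ⟨q, hq⟩ := mem_ball.1 hb'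
    rw [← p.eq_of_length_eq_zero (Nat.le_zero.1 hp), ← q.eq_of_length_eq_zero (Nat.le_zero.1 hq)]
  | succ l ih =>
    have hsub : ball X (l + 1) a ⊆ (insert a (X.neighborFinset a)).biUnion (ball X l) := by
      intro b hb
      rw [Finset.mem_biUnion]
      obtain ⟨p, hp⟩ := mem_ball.1 hb
      cases p with
      | nil => exact ⟨a, Finset.mem_insert_self _ _, mem_ball.2 ⟨.nil, Nat.zero_le l⟩⟩
      | @cons _ x _ h p =>
        exact ⟨x, Finset.mem_insert_of_mem (by simpa using h),
          mem_ball.2 ⟨p, Nat.le_of_succ_le_succ hp⟩⟩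
    have hdeg : (insert a (X.neighborFinset a)).card ≤ Δ := by
      refine (Finset.card_insert_le _ _).trans ?_
      rw [← Set.ncard_coe_finset, SimpleGraph.coe_neighborFinset]
      exact hΔ a
    calc _ ≤ _ := Finset.card_le_card hsub
      _ ≤ (insert a (X.neighborFinset a)).card * Δ ^ l :=
        Finset.card_biUnion_le_card_mul _ _ _ fun x _ => ih x
      _ ≤ Δ * Δ ^ l := Nat.mul_le_mul_right _ hdeg
      _ = Δ ^ (l + 1) := (pow_succ' Δ l).symm

end Ball

namespace BlockingSystem

variable {V : Type u} [Fintype V] {X : SimpleGraph V} {t f : ℕ} (c : BlockingSystem X t f)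

open Classical in
/-- The second vertices of the tame trails from `a` to `b` of length between `1` and `l + 1`. -/
noncomputable def steps (a b : V) (l : ℕ) : Finset V :=
  {x | ∃ (h : X.Adj a x) (p : X.Walk x b), p.length ≤ l ∧ (p.cons h).IsTrail ∧
    c.Tame (p.cons h).edges}

open Classical in
/-- The vertices at distance at most `l` from `a` that a clean walk of length at most `l` from `b`
reaches. -/
noncomputable def commonEnds (l : ℕ) (a b : V) : Finset V :=
  {s | s ∈ ball X l a ∧ ∃ q : X.Walk b s, q.length ≤ l ∧ c.Clean q.edges}

variable {c}

theorem mem_steps {a b x : V} {l : ℕ} : x ∈ c.steps a b l ↔ ∃ (h : X.Adj a x) (p : X.Walk x b),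
    p.length ≤ l ∧ (p.cons h).IsTrail ∧ c.Tame (p.cons h).edges := by
  simp only [steps, Finset.mem_filter, Finset.mem_univ, true_and]

theorem mem_commonEnds {l : ℕ} {a b s : V} : s ∈ c.commonEnds l a b ↔
    s ∈ ball X l a ∧ ∃ q : X.Walk b s, q.length ≤ l ∧ c.Clean q.edges := by
  simp only [commonEnds, Finset.mem_filter, Finset.mem_univ, true_and]

variable (c)

theorem card_steps_le {r : ℕ} (hr : 4 * r + 1 ≤ t) {l : ℕ} (hl : l ≤ r) (a b : V) :
    (c.steps a b l).card ≤ (2 * (f + 1) * (r + 1)) ^ l := by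
  classical
  induction l generalizing b with
  | zero =>
    refine Finset.card_le_one.2 fun x hx y hy => ?_
    obtain ⟨-, p, hp, -⟩ := mem_steps.1 hx
    obtain ⟨-, q, hq, -⟩ := mem_steps.1 hy
    rw [p.eq_of_length_eq_zero (Nat.le_zero.1 hp), q.eq_of_length_eq_zero (Nat.le_zero.1 hq)]
  | succ l ih =>
    obtain ⟨T, hT, hmeet⟩ := c.exists_edges_meeting_tame_trails a b (l := l + 2) (by omega)
    have hsub : c.steps a b (l + 1) ⊆
        T.biUnion fun g => g.toFinset.biUnion fun y => c.steps a y l := by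
      intro x hx
      obtain ⟨h, p, hp, htrail, htame⟩ := mem_steps.1 hx
      obtain ⟨g, hg, hgT⟩ := hmeet (p.cons h) (List.cons_ne_nil _ _) (Nat.succ_le_succ hp) htrail
        htame
      suffices ∃ y ∈ g, x ∈ c.steps a y l by
        obtain ⟨y, hy, hxy⟩ := this
        exact Finset.mem_biUnion.2 ⟨g, hgT, Finset.mem_biUnion.2 ⟨y, Sym2.mem_toFinset.2 hy, hxy⟩⟩
      rcases List.mem_cons.1 hg with rfl | hg
      · exact ⟨x, Sym2.mem_mk_right a x, mem_steps.2 ⟨h, .nil, Nat.zero_le l,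
          ⟨List.nodup_singleton _⟩, htame.mono (List.cons_subset_cons _ (List.nil_subset _))⟩⟩
      · obtain ⟨y, z, q, h', q', rfl, rfl⟩ := exists_eq_append_cons_of_mem_edges hg
        have hsubl : (q.cons h).edges.Sublist ((q.append (q'.cons h')).cons h).edges := by
          rw [SimpleGraph.Walk.edges_cons, SimpleGraph.Walk.edges_cons,
            SimpleGraph.Walk.edges_append]
          exact (List.sublist_append_left _ _).cons_cons _
        rw [SimpleGraph.Walk.length_append, SimpleGraph.Walk.length_cons] at hp
        exact ⟨y, Sym2.mem_mk_left y z, mem_steps.2 ⟨h, q, by omega,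
          ⟨hsubl.nodup htrail.edges_nodup⟩, htame.mono hsubl.subset⟩⟩
    set D := 2 * (f + 1) * (r + 1)
    calc _ ≤ _ := Finset.card_le_card hsub
      _ ≤ T.card * (2 * D ^ l) := by
        refine Finset.card_biUnion_le_card_mul _ _ _ fun g _ => ?_
        refine (Finset.card_biUnion_le_card_mul _ _ _ fun y _ => ih (by omega) y).trans ?_
        gcongr
        exact g.card_toFinset ▸ by split_ifs <;> norm_num
      _ ≤ ((f + 1) * (r + 1)) * (2 * D ^ l) := by
        gcongr
        exact hT.trans (Nat.mul_le_mul_left _ (by omega))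
      _ = D ^ (l + 1) := by ring

theorem commonEnds_subset [DecidableEq V] {a b : V} (hab : a ≠ b) (r : ℕ) :
    c.commonEnds r a b ⊆ ball X (r - 1) a ∪ (Finset.range r).biUnion fun i =>
      (ball X i a).biUnion fun x => (c.steps x b r).biUnion (ball X (r - 1 - i)) := by
  intro s hs
  obtain ⟨hsa, q, hq, hclean⟩ := mem_commonEnds.1 hs
  obtain ⟨p, hp⟩ := mem_ball.1 hsa
  rw [Finset.mem_union]
  by_cases ha : a ∈ q.support
  · refine Or.inl (mem_ball.2 ⟨q.dropUntil a ha, ?_⟩)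
    have hsplit := congrArg SimpleGraph.Walk.length (q.take_spec ha)
    rw [SimpleGraph.Walk.length_append] at hsplit
    have hpos : (q.takeUntil a ha).length ≠ 0 := fun h =>
      hab (SimpleGraph.Walk.eq_of_length_eq_zero h).symm
    omega
  · obtain ⟨x, y, p₁, h, p₂, hx, hy, rfl⟩ :=
      exists_eq_append_cons_of_notMem_of_mem p (Z := {v | v ∈ q.support}) ha q.end_mem_support
    rw [SimpleGraph.Walk.length_append, SimpleGraph.Walk.length_cons] at hp
    have hE : (q.takeUntil y hy).reverse.edges ⊆ q.edges := fun g hg =>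
      q.edges_takeUntil_subset_edges hy (by simpa using hg)
    have htrail : ((q.takeUntil y hy).reverse.cons h).IsTrail :=
      (SimpleGraph.Walk.isTrail_cons _ _).2 ⟨SimpleGraph.Walk.IsTrail.reverse _
        (SimpleGraph.Walk.IsTrail.takeUntil ⟨hclean.nodup⟩ hy),
        fun hm => hx (q.fst_mem_support_of_mem_edges (hE hm))⟩
    have hy_step : y ∈ c.steps x b r := mem_steps.2 ⟨h, (q.takeUntil y hy).reverse,
      by rw [SimpleGraph.Walk.length_reverse]; exact (q.length_takeUntil_le_length hy).trans hq,
      htrail, hclean.tame_cons (fun g hg => q.edges_subset_edgeSet hg) hE h⟩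
    refine Or.inr ?_
    simp only [Finset.mem_biUnion, Finset.mem_range]
    exact ⟨p₁.length, by omega, x, mem_ball.2 ⟨p₁, le_rfl⟩, y, hy_step,
      mem_ball.2 ⟨p₂, by omega⟩⟩

theorem card_commonEnds_le {Δ : ℕ} (hΔ : ∀ v, (X.neighborSet v).ncard < Δ) {a b : V}
    (hab : a ≠ b) {r : ℕ} (hr : 4 * r + 1 ≤ t) : (c.commonEnds r a b).card ≤
      (r + 1) * (2 * (f + 1) * (r + 1)) ^ r * Δ ^ (r - 1) := by
  classical
  set D := 2 * (f + 1) * (r + 1)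
  have hD : 1 ≤ D ^ r := Nat.one_le_pow _ _ (by positivity)
  have hbranch : ∀ i ∈ Finset.range r, ((ball X i a).biUnion fun x =>
      (c.steps x b r).biUnion (ball X (r - 1 - i))).card ≤ D ^ r * Δ ^ (r - 1) := by
    intro i hi
    calc _ ≤ (ball X i a).card * (D ^ r * Δ ^ (r - 1 - i)) := by
          refine Finset.card_biUnion_le_card_mul _ _ _ fun x _ => ?_
          refine (Finset.card_biUnion_le_card_mul _ _ _ fun y _ => card_ball_le hΔ _ y).trans ?_
          gcongr
          exact c.card_steps_le hr le_rfl x b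
      _ ≤ Δ ^ i * (D ^ r * Δ ^ (r - 1 - i)) := by
        gcongr
        exact card_ball_le hΔ i a
      _ = D ^ r * Δ ^ (r - 1) := by
        rw [mul_left_comm, ← pow_add,
          Nat.add_sub_of_le (Nat.le_sub_one_of_lt (Finset.mem_range.1 hi))]
  calc _ ≤ _ := Finset.card_le_card (c.commonEnds_subset hab r)
    _ ≤ Δ ^ (r - 1) + r * (D ^ r * Δ ^ (r - 1)) := by
      refine (Finset.card_union_le _ _).trans (add_le_add (card_ball_le hΔ _ a) ?_)
      exact (Finset.card_biUnion_le_card_mul _ _ _ hbranch).trans (by rw [Finset.card_range])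
    _ ≤ D ^ r * Δ ^ (r - 1) + r * (D ^ r * Δ ^ (r - 1)) := by
      gcongr
      exact Nat.le_mul_of_pos_left _ hD
    _ = (r + 1) * D ^ r * Δ ^ (r - 1) := by ring

/-! ### Peeling light edges -/

section Levels

variable {V : Type u} [Fintype V] {X : SimpleGraph V} {t f : ℕ} (c : BlockingSystem X t f)

open Classical in
/-- What remains of a set `S` of edges if every vertex drops its `δ` lightest edges in `S`. -/
noncomputable def peel (δ : ℕ) (S : Finset (Sym2 V)) : Finset (Sym2 V) :=
  {g ∈ S | ∀ s ∈ g, δ ≤ {h ∈ S | s ∈ h ∧ c.rank h < c.rank g}.card}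

open Classical in
/-- The `δ`-fold peelings of the set of all edges that are faults of at most `2 * f` edges. -/
noncomputable def level (δ : ℕ) : ℕ → Finset (Sym2 V)
  | 0 => {g ∈ X.edgeFinset | {e ∈ X.edgeFinset | g ∈ c.faults e}.card ≤ 2 * f}
  | j + 1 => c.peel δ (level δ j)

theorem level_antitone (δ : ℕ) : Antitone (c.level δ) :=
  antitone_nat_of_succ_le fun j => by
    classical
    rw [level, peel]
    exact Finset.filter_subset _ _

variable {c}

theorem mem_edgeSet_of_mem_level {δ j : ℕ} {g : Sym2 V} (hg : g ∈ c.level δ j) :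
    g ∈ X.edgeSet := by
  classical
  exact SimpleGraph.mem_edgeFinset.1
    (Finset.mem_filter.1 (c.level_antitone δ (Nat.zero_le j) hg)).1

open Classical in
theorem le_card_of_mem_level_succ {δ j : ℕ} {g : Sym2 V}
    (hg : g ∈ c.level δ (j + 1)) {s : V} (hs : s ∈ g) :
    δ ≤ {h ∈ c.level δ j | s ∈ h ∧ c.rank h < c.rank g}.card := by
  rw [level, peel] at hg
  exact (Finset.mem_filter.1 hg).2 s hs

variable (c)

theorem card_edgeSet_le_two_mul_level_zero (δ : ℕ) :
    X.edgeSet.ncard ≤ 2 * (c.level δ 0).card := by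
  classical
  set E := X.edgeFinset
  have hE : X.edgeSet.ncard = E.card := by
    rw [← Set.ncard_coe_finset, SimpleGraph.coe_edgeFinset]
  set T := {g ∈ E | ¬ {e ∈ E | g ∈ c.faults e}.card ≤ 2 * f}
  have hsplit : (c.level δ 0).card + T.card = E.card := Finset.card_filter_add_card_filter_not _
  have hcount : T.card * (2 * f + 1) ≤ E.card * f := by
    refine Finset.card_mul_le_card_mul (fun g e => g ∈ c.faults e) (fun g hg => ?_) fun e _ => ?_
    · exact Nat.succ_le_of_lt (not_le.1 (Finset.mem_filter.1 hg).2)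
    · exact (Finset.card_le_card fun g hg => (Finset.mem_filter.1 hg).2).trans (c.card_faults_le e)
  have hT : 2 * T.card ≤ E.card := by
    by_contra! hlt
    nlinarith only [hlt, hcount]
  omega

theorem card_le_card_peel_add (δ : ℕ) {S : Finset (Sym2 V)} (hS : ∀ g ∈ S, g ∈ X.edgeSet) :
    S.card ≤ (c.peel δ S).card + Fintype.card V * δ := by
  classical
  have hsub : S ⊆ c.peel δ S ∪ Finset.univ.biUnion fun s : V => {g ∈ {g ∈ S | s ∈ g} |
      {h ∈ {g ∈ S | s ∈ g} | c.rank h < c.rank g}.card < δ} := by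
    intro g hg
    by_cases hpeel : g ∈ c.peel δ S
    · exact Finset.mem_union_left _ hpeel
    · simp only [peel, Finset.mem_filter, hg, true_and, not_forall, not_le] at hpeel
      obtain ⟨s, hs, hlt⟩ := hpeel
      refine Finset.mem_union_right _ (Finset.mem_biUnion.2 ⟨s, Finset.mem_univ s,
        Finset.mem_filter.2 ⟨Finset.mem_filter.2 ⟨hg, hs⟩, ?_⟩⟩)
      rwa [Finset.filter_filter]
  refine (Finset.card_le_card hsub).trans ((Finset.card_union_le _ _).trans ?_)
  gcongr
  refine Finset.card_biUnion_le_card_mul _ _ δ fun s _ => card_filter_few_below_le ?_ δ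
  exact c.rank_injOn.mono fun g hg => hS g (Finset.mem_filter.1 hg).1

theorem card_edgeSet_le_level (δ j : ℕ) :
    X.edgeSet.ncard ≤ 2 * ((c.level δ j).card + j * (Fintype.card V * δ)) := by
  induction j with
  | zero => simpa only [zero_mul, add_zero] using c.card_edgeSet_le_two_mul_level_zero δ
  | succ j ih =>
    have hpeel : (c.level δ j).card ≤ (c.level δ (j + 1)).card + Fintype.card V * δ :=
      c.card_le_card_peel_add δ fun _ => mem_edgeSet_of_mem_level
    rw [add_one_mul]
    omega

variable {c}

open Classical in
theorem card_filter_rel_le {δ : ℕ} {g : Sym2 V} (hg : g ∈ c.level δ 0) (S : Finset (Sym2 V)) :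
    {h ∈ S | c.Rel g h}.card ≤ (2 * f + 1) * (f + 1) := by
  set I := {e ∈ X.edgeFinset | g ∈ c.faults e}
  have hsub : {h ∈ S | c.Rel g h} ⊆ (insert g I).biUnion fun e => insert e (c.faults e) := by
    intro h hh
    obtain ⟨e, he, hge, hhe⟩ := (Finset.mem_filter.1 hh).2
    refine Finset.mem_biUnion.2 ⟨e, Finset.mem_insert.2 (hge.imp Eq.symm fun hge => ?_),
      Finset.mem_insert.2 hhe⟩
    exact Finset.mem_filter.2 ⟨SimpleGraph.mem_edgeFinset.2 he, hge⟩
  have hI : I.card ≤ 2 * f := (Finset.mem_filter.1 hg).2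
  refine (Finset.card_le_card hsub).trans ((Finset.card_biUnion_le_card_mul _ _ (f + 1)
    fun e _ => (Finset.card_insert_le _ _).trans (Nat.succ_le_succ (c.card_faults_le e))).trans ?_)
  gcongr
  exact (Finset.card_insert_le _ _).trans (Nat.succ_le_succ hI)

end Levels

/-! ### Arms -/

section Arms

variable {V : Type u} {X : SimpleGraph V} {t f : ℕ} (c : BlockingSystem X t f)

/-- A list of edges avoids `e` if its members are lighter than `e` and are no faults of `e`. -/
def Avoids (e : Sym2 V) (l : List (Sym2 V)) : Prop :=
  ∀ h ∈ l, c.rank h < c.rank e ∧ h ∉ c.faults e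

/-- An arm of an edge `e` is a clean walk that avoids `e`; it is meant to start in an end of
`e`. -/
structure IsArm (e : Sym2 V) {a b : V} (p : X.Walk a b) : Prop where
  clean : c.Clean p.edges
  avoids : c.Avoids e p.edges

/-- An arm of `e` within level `0` with the property that some edge of level `j` at its far end is
not heavier than `e` and the edges of the arm. If `0 < j`, then there are `δ` lighter edges of level
`j - 1` at this end. -/
structure IsExtendableArm [Fintype V] (δ j : ℕ) (e : Sym2 V) {a b : V} (p : X.Walk a b) :
    Prop extends c.IsArm e p where
  mem_level_zero : ∀ h ∈ p.edges, h ∈ c.level δ 0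
  exists_mem_level : ∃ g ∈ c.level δ j, b ∈ g ∧ ∀ h ∈ e :: p.edges, c.rank g ≤ c.rank h

variable [Fintype V]

open Classical in
/-- The vertices by which an arm `p` of `e` can be prolonged to an extendable arm. -/
noncomputable def extensions (δ j : ℕ) (e : Sym2 V) {a b : V} (p : X.Walk a b) : Finset V :=
  {x | ∃ h : X.Adj b x, c.IsExtendableArm δ j e (p.concat h)}

open Classical in
/-- The far ends of the extendable arms of `e` of length `i` that start in `a`. -/
noncomputable def extendableEnds (δ j : ℕ) (e : Sym2 V) (i : ℕ) (a : V) : Finset V :=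
  {b | ∃ p : X.Walk a b, p.length = i ∧ c.IsExtendableArm δ j e p}

open Classical in
/-- The far ends of the arms of `e` of length `i` that start in `a`. -/
noncomputable def armEnds (e : Sym2 V) (i : ℕ) (a : V) : Finset V :=
  {b | ∃ p : X.Walk a b, p.length = i ∧ c.IsArm e p}

variable {c} {δ j : ℕ} {e : Sym2 V} {a b x : V}

theorem mem_extensions {p : X.Walk a b} :
    x ∈ c.extensions δ j e p ↔ ∃ h : X.Adj b x, c.IsExtendableArm δ j e (p.concat h) := by
  simp only [extensions, Finset.mem_filter, Finset.mem_univ, true_and]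

theorem mem_extendableEnds {i : ℕ} : b ∈ c.extendableEnds δ j e i a ↔
    ∃ p : X.Walk a b, p.length = i ∧ c.IsExtendableArm δ j e p := by
  simp only [extendableEnds, Finset.mem_filter, Finset.mem_univ, true_and]

theorem mem_armEnds {i : ℕ} :
    b ∈ c.armEnds e i a ↔ ∃ p : X.Walk a b, p.length = i ∧ c.IsArm e p := by
  simp only [armEnds, Finset.mem_filter, Finset.mem_univ, true_and]

theorem isExtendableArm_nil (he : e ∈ c.level δ j) (ha : a ∈ e) :
    c.IsExtendableArm δ j e (.nil : X.Walk a a) where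
  clean := List.Pairwise.nil
  avoids := fun _ hh => absurd hh List.not_mem_nil
  mem_level_zero := fun _ hh => absurd hh List.not_mem_nil
  exists_mem_level := ⟨e, he, ha, fun _ hh => (congrArg c.rank (List.mem_singleton.1 hh)).ge⟩

theorem IsExtendableArm.mem_extensions {i : ℕ} {p : X.Walk a b} (hp : c.IsExtendableArm δ i e p)
    (hlevel : s(b, x) ∈ c.level δ j) (hrank : ∀ h ∈ e :: p.edges, c.rank s(b, x) < c.rank h)
    (hfault : s(b, x) ∉ c.faults e) (hrel : ∀ h ∈ p.edges, ¬ c.Rel h s(b, x)) :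
    x ∈ c.extensions δ j e p := by
  have hadj : X.Adj b x := mem_edgeSet_of_mem_level hlevel
  have hmem : ∀ h, h ∈ (p.concat hadj).edges ↔ h ∈ p.edges ∨ h = s(b, x) := fun h => by
    rw [SimpleGraph.Walk.edges_concat, List.concat_eq_append, List.mem_append, List.mem_singleton]
  refine BlockingSystem.mem_extensions.2 ⟨hadj, ⟨?_, fun h hh => ?_⟩, fun h hh => ?_, s(b, x),
    hlevel, Sym2.mem_mk_right b x, fun h hh => ?_⟩
  · rw [SimpleGraph.Walk.edges_concat, List.concat_eq_append, Clean, List.pairwise_append]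
    refine ⟨hp.clean, List.pairwise_singleton _ _, fun h hh h' hh' => ?_⟩
    obtain rfl := List.mem_singleton.1 hh'
    exact ⟨hrank h (List.mem_cons_of_mem _ hh), hrel h hh⟩
  · rcases (hmem h).1 hh with hh | rfl
    exacts [hp.avoids h hh, ⟨hrank e List.mem_cons_self, hfault⟩]
  · rcases (hmem h).1 hh with hh | rfl
    exacts [hp.mem_level_zero h hh, c.level_antitone δ (Nat.zero_le j) hlevel]
  · rcases List.mem_cons.1 hh with rfl | hh
    · exact (hrank h List.mem_cons_self).le
    · rcases (hmem h).1 hh with hh | rfl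
      exacts [(hrank h (List.mem_cons_of_mem _ hh)).le, le_rfl]

theorem IsExtendableArm.le_card_extensions {m : ℕ} {p : X.Walk a b}
    (hp : c.IsExtendableArm δ (j + 1) e p)
    (hm : m + f + p.length * ((2 * f + 1) * (f + 1)) ≤ δ) :
    m ≤ (c.extensions δ j e p).card := by
  classical
  obtain ⟨g, hg, hbg, hmin⟩ := hp.exists_mem_level
  set A := {h ∈ c.level δ j | b ∈ h ∧ c.rank h < c.rank g}
  have hA : δ ≤ A.card := le_card_of_mem_level_succ hg hbg
  set R := p.edges.toFinset.biUnion fun h => {h' ∈ A | c.Rel h h'}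
  have hR : R.card ≤ p.length * ((2 * f + 1) * (f + 1)) := by
    refine (Finset.card_biUnion_le_card_mul _ _ _ fun h hh =>
      card_filter_rel_le (hp.mem_level_zero h (List.mem_toFinset.1 hh)) A).trans ?_
    gcongr
    exact (List.toFinset_card_le _).trans p.length_edges.le
  have hsub : A ⊆ ((c.extensions δ j e p).image fun x => s(b, x)) ∪ (c.faults e ∪ R) := by
    intro h hh
    obtain ⟨hlevel, hb, hlt⟩ := Finset.mem_filter.1 hh
    rw [Finset.mem_union, Finset.mem_union, or_iff_not_imp_right, not_or]
    rintro ⟨hfault, hrel⟩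
    obtain ⟨x, rfl⟩ := hb
    refine Finset.mem_image_of_mem _ (hp.mem_extensions hlevel
      (fun h' hh' => hlt.trans_le (hmin h' hh')) hfault fun h' hh' hrel' => ?_)
    exact hrel (Finset.mem_biUnion.2 ⟨h', List.mem_toFinset.2 hh', Finset.mem_filter.2 ⟨hh, hrel'⟩⟩)
  have hA' := (Finset.card_le_card hsub).trans (Finset.card_union_le _ _)
  have hFR := Finset.card_union_le (c.faults e) R
  have himage := Finset.card_image_le (s := c.extensions δ j e p) (f := fun x => s(b, x))
  have hF := c.card_faults_le e
  omega

theorem disjoint_extensions {p : X.Walk a b} {y : V} {q : X.Walk a y} (hby : b ≠ y)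
    (hpq : p.length = q.length) (hlen : 4 * (p.length + 1) ≤ t + 3) :
    Disjoint (c.extensions δ j e p) (c.extensions δ j e q) := by
  refine Finset.disjoint_left.2 fun x hxp hxq => hby ?_
  obtain ⟨hb, hp⟩ := mem_extensions.1 hxp
  obtain ⟨hy, hq⟩ := mem_extensions.1 hxq
  have heq : p.concat hb = q.concat hy := hp.clean.walk_ext hq.clean
    (by rw [SimpleGraph.Walk.length_concat, SimpleGraph.Walk.length_concat, hpq])
    (by rwa [SimpleGraph.Walk.length_concat])
  simpa only [SimpleGraph.Walk.penultimate_concat] using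
    congrArg SimpleGraph.Walk.penultimate heq

theorem pow_le_card_extendableEnds {m : ℕ} (ha : a ∈ e) {i : ℕ} (he : e ∈ c.level δ (j + i))
    (hm : m + f + (i - 1) * ((2 * f + 1) * (f + 1)) ≤ δ) (hi : 4 * i ≤ t + 3) :
    m ^ i ≤ (c.extendableEnds δ j e i a).card := by
  classical
  induction i generalizing j with
  | zero =>
    rw [pow_zero]
    exact Finset.card_pos.2 ⟨a, mem_extendableEnds.2 ⟨.nil, rfl, isExtendableArm_nil he ha⟩⟩
  | succ i ih =>
    rw [Nat.add_sub_cancel] at hm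
    have hstep : i - 1 ≤ i := Nat.sub_le i 1
    set S := c.extendableEnds δ (j + 1) e i a
    have hS : m ^ i ≤ S.card := ih (by rwa [add_right_comm])
      (le_trans (by gcongr) hm) (by omega)
    choose p hlen hp using fun s : S => mem_extendableEnds.1 s.2
    have hsub : Finset.univ.biUnion (fun s => c.extensions δ j e (p s)) ⊆
        c.extendableEnds δ j e (i + 1) a := by
      intro x hx
      obtain ⟨s, -, hx⟩ := Finset.mem_biUnion.1 hx
      obtain ⟨h, hpx⟩ := mem_extensions.1 hx
      exact mem_extendableEnds.2 ⟨_, by rw [SimpleGraph.Walk.length_concat, hlen], hpx⟩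
    calc m ^ (i + 1) ≤ S.card * m := by rw [pow_succ]; gcongr
      _ ≤ ∑ s : S, (c.extensions δ j e (p s)).card := by
        rw [← Fintype.card_coe, ← smul_eq_mul]
        exact Finset.card_nsmul_le_sum _ _ m fun s _ =>
          (hp s).le_card_extensions (by rwa [hlen])
      _ = _ := (Finset.card_biUnion fun s _ s' _ hne => disjoint_extensions
          (Subtype.coe_injective.ne hne) ((hlen s).trans (hlen s').symm) (by rwa [hlen])).symm
      _ ≤ _ := Finset.card_le_card hsub

theorem pow_le_card_armEnds {m : ℕ} (ha : a ∈ e) {i : ℕ} (he : e ∈ c.level δ i)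
    (hm : m + f + (i - 1) * ((2 * f + 1) * (f + 1)) ≤ δ) (hi : 4 * i ≤ t + 3) :
    m ^ i ≤ (c.armEnds e i a).card := by
  refine (pow_le_card_extendableEnds (j := 0) ha (by rwa [zero_add]) hm hi).trans
    (Finset.card_le_card fun s hs => ?_)
  obtain ⟨p, hlen, hp⟩ := mem_extendableEnds.1 hs
  exact mem_armEnds.2 ⟨p, hlen, hp.toIsArm⟩

end Arms

end BlockingSystem

/-! ### Collisions of arm ends -/

theorem card_mul_le_of_card_repeated_le {α β : Type*} [Fintype β] [DecidableEq β] {S : Finset α}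
    {rk : α → ℕ} (hrk : Set.InjOn rk S) {P : α → Finset β} {K M : ℕ}
    (hK : ∀ e ∈ S, K ≤ (P e).card)
    (hM : ∀ e ∈ S, {x ∈ P e | ∃ e' ∈ S, rk e' < rk e ∧ x ∈ P e'}.card ≤ M) :
    S.card * K ≤ Fintype.card β + S.card * M := by
  set fresh : α → Finset β := fun e => {x ∈ P e | ¬ ∃ e' ∈ S, rk e' < rk e ∧ x ∈ P e'}
  have hfresh : ∀ e ∈ S, K ≤ (fresh e).card + M := fun e he => by
    have hsplit : _ + (fresh e).card = (P e).card :=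
      Finset.card_filter_add_card_filter_not fun x => ∃ e' ∈ S, rk e' < rk e ∧ x ∈ P e'
    have hKe := hK e he
    have hMe := hM e he
    omega
  have hlt : ∀ e ∈ S, ∀ e' ∈ S, rk e < rk e' → Disjoint (fresh e) (fresh e') :=
    fun e he e' _ hlt => Finset.disjoint_left.2 fun x hx hx' =>
      (Finset.mem_filter.1 hx').2 ⟨e, he, hlt, (Finset.mem_filter.1 hx).1⟩
  have hdisj : (S : Set α).PairwiseDisjoint fresh := fun e he e' he' hne => by
    rcases lt_trichotomy (rk e) (rk e') with h | h | h
    exacts [hlt e he e' he' h, absurd (hrk he he' h) hne, (hlt e' he' e he h).symm]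
  calc S.card * K ≤ ∑ e ∈ S, ((fresh e).card + M) := by
        rw [← smul_eq_mul]
        exact Finset.card_nsmul_le_sum _ _ K hfresh
    _ = (S.biUnion fresh).card + S.card * M := by
      rw [Finset.sum_add_distrib, Finset.sum_const, smul_eq_mul, Finset.card_biUnion hdisj]
    _ ≤ Fintype.card β + S.card * M := by
      gcongr
      exact Finset.card_le_univ _

namespace BlockingSystem

section Collisions

variable {V : Type u} {X : SimpleGraph V} {t f : ℕ} {c : BlockingSystem X t f}

theorem Avoids.append {e : Sym2 V} {x y z : V} {p : X.Walk x y} {q : X.Walk y z}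
    (hp : c.Avoids e p.edges) (hq : c.Avoids e q.edges) : c.Avoids e (p.append q).edges := by
  rw [SimpleGraph.Walk.edges_append]
  exact List.forall_mem_append.2 ⟨hp, hq⟩

theorem Avoids.reverse {e : Sym2 V} {x y : V} {p : X.Walk x y} (hp : c.Avoids e p.edges) :
    c.Avoids e p.reverse.edges := fun g hg => hp g (by simpa using hg)

theorem Avoids.mem_faults {u v b d : V} (huv : X.Adj u v) (hbd : X.Adj b d)
    (hlt : c.rank s(b, d) < c.rank s(u, v)) {p : X.Walk u b} {q : X.Walk d v}
    (hp : c.Avoids s(u, v) p.edges) (hq : c.Avoids s(u, v) q.edges)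
    (hlen : p.length + q.length + 1 ≤ t) : s(b, d) ∈ c.faults s(u, v) := by
  have hmem : ∀ g, g ∈ (p.append (q.cons hbd)).edges → g = s(b, d) ∨
      c.rank g < c.rank s(u, v) ∧ g ∉ c.faults s(u, v) := fun g hg => by
    rw [SimpleGraph.Walk.edges_append, SimpleGraph.Walk.edges_cons, List.mem_append,
      List.mem_cons] at hg
    rcases hg with hg | hg | hg
    exacts [Or.inr (hp g hg), Or.inl hg, Or.inr (hq g hg)]
  obtain ⟨g, hg, hgF⟩ := c.exists_mem_faults huv (p.append (q.cons hbd))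
    (fun g hg => (hmem g hg).elim (fun h => h ▸ hlt) And.left)
    (by rwa [SimpleGraph.Walk.length_append, SimpleGraph.Walk.length_cons, ← add_assoc])
  exact (hmem g hg).elim (fun h => h ▸ hgF) fun h => absurd hgF h.2

theorem Avoids.not_adj {u v d : V} (huv : X.Adj u v) (hlt : c.rank s(u, d) < c.rank s(u, v))
    {q : X.Walk d v} (hq : c.Avoids s(u, v) q.edges) (hlen : 2 * (q.length + 1) ≤ t + 1) :
    ¬ X.Adj u d := by
  intro hud
  obtain ⟨g, ⟨hg, hgF⟩, h, ⟨hh, hhF⟩, hgh⟩ := c.nontrivial_faults huv (q.cons hud)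
    (List.forall_mem_cons.2 ⟨hlt, fun g hg => (hq g hg).1⟩) hlen
  have heq : ∀ {g}, g ∈ (q.cons hud).edges → g ∈ c.faults s(u, v) → g = s(u, d) := fun hg hgF =>
    (List.mem_cons.1 hg).resolve_right fun hg => (hq _ hg).2 hgF
  exact hgh ((heq hg hgF).trans (heq hh hhF).symm)

end Collisions

variable {V : Type u} [Fintype V] {X : SimpleGraph V} {t f : ℕ} (c : BlockingSystem X t f)

open Classical in
/-- The vertices at distance at most `l` from a fault of `e`. -/
noncomputable def faultBall (l : ℕ) (e : Sym2 V) : Finset V :=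
  (c.faults e).biUnion fun g => g.toFinset.biUnion (ball X l)

theorem card_faultBall_le {Δ : ℕ} (hΔ : ∀ v, (X.neighborSet v).ncard < Δ) (l : ℕ) (e : Sym2 V) :
    (c.faultBall l e).card ≤ f * (2 * Δ ^ l) := by
  classical
  refine (Finset.card_biUnion_le_card_mul _ _ (2 * Δ ^ l) fun g _ => ?_).trans
    (Nat.mul_le_mul_right _ (c.card_faults_le e))
  refine (Finset.card_biUnion_le_card_mul _ _ _ fun z _ => card_ball_le hΔ l z).trans
    (Nat.mul_le_mul_right _ ?_)
  rw [Sym2.card_toFinset]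
  split_ifs <;> norm_num

variable {c}

theorem mem_faultBall {e g : Sym2 V} {a s : V} {p : X.Walk a s} (hg : g ∈ p.edges)
    (hgF : g ∈ c.faults e) : s ∈ c.faultBall (p.length - 1) e := by
  classical
  obtain ⟨x, y, q, h, q', rfl, rfl⟩ := exists_eq_append_cons_of_mem_edges hg
  refine Finset.mem_biUnion.2 ⟨_, hgF, Finset.mem_biUnion.2
    ⟨y, Sym2.mem_toFinset.2 (Sym2.mem_mk_right x y), mem_ball.2 ⟨q', ?_⟩⟩⟩
  rw [SimpleGraph.Walk.length_append, SimpleGraph.Walk.length_cons]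
  omega

theorem mem_faultBall_or_avoids {e e' : Sym2 V} (hlt : c.rank e' < c.rank e) {r : ℕ} {b s : V}
    (hs : s ∈ c.armEnds e' r b) :
    s ∈ c.faultBall (r - 1) e ∨ ∃ p : X.Walk b s, p.length = r ∧ c.Clean p.edges ∧
      c.Avoids e p.edges := by
  obtain ⟨p, rfl, hp⟩ := mem_armEnds.1 hs
  by_cases hfault : ∃ g ∈ p.edges, g ∈ c.faults e
  · obtain ⟨g, hg, hgF⟩ := hfault
    exact Or.inl (mem_faultBall hg hgF)
  · push Not at hfault
    exact Or.inr ⟨p, rfl, hp.clean, fun g hg => ⟨(hp.avoids g hg).1.trans hlt, hfault g hg⟩⟩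

theorem mem_faultBall_or_commonEnds {e e' : Sym2 V} (he : e ∈ X.edgeSet) (he' : e' ∈ X.edgeSet)
    (hlt : c.rank e' < c.rank e) {u v b d : V} (huv : s(u, v) = e) (hbd : s(b, d) = e') {r : ℕ}
    (hr : 4 * r + 1 ≤ t) {s z : V} (hs : s ∈ c.armEnds e r u) (hz : z ∈ c.armEnds e r v)
    (hs' : s ∈ c.armEnds e' r b) (hz' : z ∈ c.armEnds e' r d) :
    s ∈ c.faultBall (r - 1) e ∨ z ∈ c.faultBall (r - 1) e ∨
      e' ∈ c.faults e ∧ u ≠ b ∧ v ≠ d ∧ s ∈ c.commonEnds r u b ∧ z ∈ c.commonEnds r v d := by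
  subst huv hbd
  rcases mem_faultBall_or_avoids hlt hs' with hs' | ⟨p', hp'l, hp'c, hp'a⟩
  · exact Or.inl hs'
  rcases mem_faultBall_or_avoids hlt hz' with hz' | ⟨q', hq'l, hq'c, hq'a⟩
  · exact Or.inr (Or.inl hz')
  obtain ⟨p, hpl, hp⟩ := mem_armEnds.1 hs
  obtain ⟨q, hql, hq⟩ := mem_armEnds.1 hz
  have hub_avoids : c.Avoids s(u, v) (p.append p'.reverse).edges := hp.avoids.append hp'a.reverse
  have hdv_avoids : c.Avoids s(u, v) (q'.append q.reverse).edges := hq'a.append hq.avoids.reverse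
  have hub_len : (p.append p'.reverse).length = 2 * r := by
    rw [SimpleGraph.Walk.length_append, SimpleGraph.Walk.length_reverse]; omega
  have hdv_len : (q'.append q.reverse).length = 2 * r := by
    rw [SimpleGraph.Walk.length_append, SimpleGraph.Walk.length_reverse]; omega
  refine Or.inr (Or.inr ⟨hub_avoids.mem_faults he he' hlt hdv_avoids (by omega), ?_, ?_,
    mem_commonEnds.2 ⟨mem_ball.2 ⟨p, hpl.le⟩, p', hp'l.le, hp'c⟩,
    mem_commonEnds.2 ⟨mem_ball.2 ⟨q, hql.le⟩, q', hq'l.le, hq'c⟩⟩)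
  · rintro rfl
    exact hdv_avoids.not_adj he hlt (by omega) he'
  · rintro rfl
    rw [Sym2.eq_swap (a := u)] at hub_avoids hlt
    rw [Sym2.eq_swap (a := b)] at hlt
    exact hub_avoids.reverse.not_adj he.symm hlt
      (by rw [SimpleGraph.Walk.length_reverse]; omega) he'.symm

variable (c)

/-- The pairs of far ends of two arms of `e` of length `r`, one for each end of `e`. -/
noncomputable def pairs (r : ℕ) (e : Sym2 V) : Finset (V × V) :=
  c.armEnds e r e.out.1 ×ˢ c.armEnds e r e.out.2

theorem card_armEnds_le {Δ : ℕ} (hΔ : ∀ v, (X.neighborSet v).ncard < Δ) (e : Sym2 V) (r : ℕ)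
    (a : V) : (c.armEnds e r a).card ≤ Δ ^ r := by
  refine (Finset.card_le_card fun s hs => ?_).trans (card_ball_le hΔ r a)
  obtain ⟨p, hp, -⟩ := mem_armEnds.1 hs
  exact mem_ball.2 ⟨p, hp.le⟩

variable {c} in
theorem repeated_pairs_subset [DecidableEq V] {r : ℕ} (hr : 4 * r + 1 ≤ t) {e : Sym2 V}
    (he : e ∈ X.edgeSet) {S : Finset (Sym2 V)} (hS : ∀ e' ∈ S, e' ∈ X.edgeSet) :
    {x ∈ c.pairs r e | ∃ e' ∈ S, c.rank e' < c.rank e ∧ x ∈ c.pairs r e'} ⊆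
      (c.faultBall (r - 1) e ×ˢ c.armEnds e r e.out.2 ∪
        c.armEnds e r e.out.1 ×ˢ c.faultBall (r - 1) e) ∪
      {e' ∈ c.faults e | e.out.1 ≠ e'.out.1 ∧ e.out.2 ≠ e'.out.2}.biUnion fun e' =>
        c.commonEnds r e.out.1 e'.out.1 ×ˢ c.commonEnds r e.out.2 e'.out.2 := by
  rintro ⟨s, z⟩ hx
  obtain ⟨hx, e', he', hlt, hx'⟩ := Finset.mem_filter.1 hx
  obtain ⟨hs, hz⟩ := Finset.mem_product.1 hx
  obtain ⟨hs', hz'⟩ := Finset.mem_product.1 hx'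
  simp only [Finset.mem_union, Finset.mem_product, Finset.mem_biUnion, Finset.mem_filter]
  rcases mem_faultBall_or_commonEnds he (hS e' he') hlt (Quot.out_eq e) (Quot.out_eq e') hr hs hz
    hs' hz' with hsF | hzF | ⟨hF, hne₁, hne₂, hsC, hzC⟩
  · exact Or.inl (Or.inl ⟨hsF, hz⟩)
  · exact Or.inl (Or.inr ⟨hs, hzF⟩)
  · exact Or.inr ⟨e', ⟨hF, hne₁, hne₂⟩, hsC, hzC⟩

/-- A bound for the number of pairs of arm ends that an edge shares with lighter edges, for graphs
of maximum degree less than `Δ`. Pairs with a member close to a fault contribute the first summand,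
and pairs shared with a fault contribute the second one. -/
def collisionBound (f Δ r : ℕ) : ℕ :=
  2 * (f * (2 * Δ ^ (r - 1)) * Δ ^ r) +
    f * ((r + 1) * (2 * (f + 1) * (r + 1)) ^ r * Δ ^ (r - 1)) ^ 2

theorem card_repeated_pairs_le [DecidableEq V] {Δ : ℕ} (hΔ : ∀ v, (X.neighborSet v).ncard < Δ)
    {r : ℕ} (hr : 4 * r + 1 ≤ t) {e : Sym2 V} (he : e ∈ X.edgeSet) {S : Finset (Sym2 V)}
    (hS : ∀ e' ∈ S, e' ∈ X.edgeSet) :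
    {x ∈ c.pairs r e | ∃ e' ∈ S, c.rank e' < c.rank e ∧ x ∈ c.pairs r e'}.card ≤
      collisionBound f Δ r := by
  refine (Finset.card_le_card (repeated_pairs_subset hr he hS)).trans
    ((Finset.card_union_le _ _).trans (Nat.add_le_add ?_ ?_))
  · refine (Finset.card_union_le _ _).trans ?_
    rw [Finset.card_product, Finset.card_product, two_mul, mul_comm (c.armEnds e r _).card]
    gcongr
    exacts [c.card_faultBall_le hΔ _ e, c.card_armEnds_le hΔ e r _, c.card_faultBall_le hΔ _ e,
      c.card_armEnds_le hΔ e r _]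
  · refine (Finset.card_biUnion_le_card_mul _ _ _ fun e' he' => ?_).trans
      (Nat.mul_le_mul_right _ ((Finset.card_filter_le _ _).trans (c.card_faults_le e)))
    obtain ⟨-, hne₁, hne₂⟩ := Finset.mem_filter.1 he'
    rw [Finset.card_product, sq]
    exact Nat.mul_le_mul (c.card_commonEnds_le hΔ hne₁ hr) (c.card_commonEnds_le hΔ hne₂ hr)

theorem card_level_mul_pow_le {Δ δ m r : ℕ} (hΔ : ∀ v, (X.neighborSet v).ncard < Δ)
    (hr : 4 * r + 1 ≤ t) (hm : m + f + (r - 1) * ((2 * f + 1) * (f + 1)) ≤ δ) :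
    (c.level δ r).card * m ^ (2 * r) ≤
      Fintype.card V ^ 2 + (c.level δ r).card * collisionBound f Δ r := by
  classical
  have hE : ∀ e ∈ c.level δ r, e ∈ X.edgeSet := fun _ => mem_edgeSet_of_mem_level
  rw [sq, ← Fintype.card_prod]
  refine card_mul_le_of_card_repeated_le (c.rank_injOn.mono hE) (P := c.pairs r) (fun e he => ?_)
    fun e he => c.card_repeated_pairs_le hΔ hr (hE e he) hE
  rw [pairs, Finset.card_product, two_mul, pow_add]
  exact Nat.mul_le_mul (pow_le_card_armEnds (Sym2.out_fst_mem e) he hm (by omega))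
    (pow_le_card_armEnds (Sym2.out_snd_mem e) he hm (by omega))

end BlockingSystem

/-! ### The greedy emulator -/

section Distance

variable {V : Type u} {G H : SimpleGraph V} {w : Sym2 V → ℝ≥0∞} {a b : V}

theorem walkWeight_append {x : V} (p : G.Walk a b) (q : G.Walk b x) :
    walkWeight w (p.append q) = walkWeight w p + walkWeight w q := by
  simp [walkWeight]

theorem walkWeight_cons {x : V} (h : G.Adj a b) (p : G.Walk b x) :
    walkWeight w (p.cons h) = w s(a, b) + walkWeight w p := by
  simp [walkWeight]

theorem walkWeight_transfer (p : G.Walk a b) (h : ∀ e ∈ p.edges, e ∈ H.edgeSet) :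
    walkWeight w (p.transfer H h) = walkWeight w p := by
  simp [walkWeight]

theorem walkWeight_le_length_mul {m : ℝ≥0∞} {p : G.Walk a b} (h : ∀ e ∈ p.edges, w e ≤ m) :
    walkWeight w p ≤ p.length * m := by
  simpa [walkWeight, nsmul_eq_mul] using
    List.sum_le_card_nsmul (p.edges.map w) m (List.forall_mem_map.2 h)

theorem wdist_le_walkWeight (p : G.Walk a b) : wdist G w a b ≤ walkWeight w p :=
  iInf_le _ p

theorem wdist_self : wdist G w a a = 0 :=
  le_antisymm (wdist_le_walkWeight .nil) zero_le

theorem wdist_le_of_adj (h : G.Adj a b) : wdist G w a b ≤ w s(a, b) :=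
  (wdist_le_walkWeight h.toWalk).trans_eq (by simp [walkWeight])

theorem wdist_triangle (x : V) : wdist G w a b ≤ wdist G w a x + wdist G w x b :=
  ENNReal.le_iInf_add_iInf fun p q => walkWeight_append p q ▸ wdist_le_walkWeight (p.append q)

theorem wdist_le_wdist_emulatorWeight :
    wdist G w a b ≤ wdist H (emulatorWeight G w) a b := by
  refine le_iInf fun p => ?_
  induction p with
  | nil => exact wdist_self.trans_le zero_le
  | @cons a x b h p ih =>
    rw [walkWeight_cons]
    exact (wdist_triangle x).trans (add_le_add_right ih _)

theorem isEmulator_of_forall_adj {t : ℝ≥0} (ht : t ≠ 0)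
    (h : ∀ a b, G.Adj a b → wdist H (emulatorWeight G w) a b ≤ t * w s(a, b)) :
    IsEmulator G w t H := by
  refine fun a b => ⟨wdist_le_wdist_emulatorWeight, ?_⟩
  rw [wdist.eq_1 G, ENNReal.mul_iInf_of_ne (ENNReal.coe_ne_zero.2 ht) ENNReal.coe_ne_top]
  refine le_iInf fun p => ?_
  induction p with
  | nil => exact wdist_self.trans_le zero_le
  | @cons a x b hadj p ih =>
    rw [walkWeight_cons, mul_add]
    exact (wdist_triangle x).trans (add_le_add (h a x hadj) ih)

end Distance

section Greedy

variable {V : Type u}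

/-- The weight function of an emulator of `(G \ F, w)`. -/
noncomputable def faultWeight (G : SimpleGraph V) (w : Sym2 V → ℝ≥0) (F : Finset (Sym2 V)) :
    Sym2 V → ℝ≥0∞ :=
  emulatorWeight (G.deleteEdges (F : Set (Sym2 V))) fun e => (w e : ℝ≥0∞)

/-- The faults `F` force an edge `e` of `G` into a `t`-emulator of `G` that contains only `H` so
far, as the distance in `H` between the ends of `e` is too large in `G \ F`. -/
structure IsObstruction (G H : SimpleGraph V) (w : Sym2 V → ℝ≥0) (f : ℕ) (t : ℝ≥0) (e : Sym2 V)
    (F : Finset (Sym2 V)) : Prop where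
  card_le : F.card ≤ f
  notMem : e ∉ F
  lt_emulatorWeight : t * w e < emulatorWeight H (faultWeight G w F) e

/-- The spanning subgraph of `H` whose edges have smaller rank than `e`. -/
def lighterPart (H : SimpleGraph V) (rank : Sym2 V → ℕ) (e : Sym2 V) : SimpleGraph V :=
  SimpleGraph.fromEdgeSet {g ∈ H.edgeSet | rank g < rank e}

/-- `H` is the output of the algorithm that considers the edges of `G` by increasing rank and keeps
those that have an obstruction against the edges kept before. -/
def IsGreedy (G : SimpleGraph V) (w : Sym2 V → ℝ≥0) (f : ℕ) (t : ℝ≥0) (rank : Sym2 V → ℕ)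
    (H : SimpleGraph V) : Prop :=
  ∀ e, e ∈ H.edgeSet ↔ e ∈ G.edgeSet ∧ ∃ F, IsObstruction G (lighterPart H rank e) w f t e F

variable {G H : SimpleGraph V} {w : Sym2 V → ℝ≥0} {f : ℕ} {F : Finset (Sym2 V)}

theorem exists_isGreedy (G : SimpleGraph V) (w : Sym2 V → ℝ≥0) (f : ℕ) (t : ℝ≥0)
    (rank : Sym2 V → ℕ) : ∃ H, IsGreedy G w f t rank H := by
  obtain ⟨S, hS⟩ := exists_greedy_selection rank fun T e =>
    e ∈ G.edgeSet ∧ ∃ F, IsObstruction G (SimpleGraph.fromEdgeSet T) w f t e F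
  have hedges : (SimpleGraph.fromEdgeSet S).edgeSet = S := by
    rw [SimpleGraph.edgeSet_fromEdgeSet, sdiff_eq_left, Set.disjoint_left]
    exact fun e he => G.not_isDiag_of_mem_edgeSet ((hS e).1 he).1
  exact ⟨SimpleGraph.fromEdgeSet S, fun e => by rw [lighterPart, hedges, hS e]⟩

theorem wdist_le_wdist_lighterPart {ω : Sym2 V → ℝ≥0∞} {rank : Sym2 V → ℕ} (e : Sym2 V) (a b : V) :
    wdist H ω a b ≤ wdist (lighterPart H rank e) ω a b := by
  refine le_iInf fun p => ?_
  have hp : ∀ g ∈ p.edges, g ∈ H.edgeSet := fun g hg => by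
    have hg' := p.edges_subset_edgeSet hg
    rw [lighterPart, SimpleGraph.edgeSet_fromEdgeSet] at hg'
    exact hg'.1.1
  exact walkWeight_transfer p hp ▸ wdist_le_walkWeight _

theorem faultWeight_le_length_mul {a b : V} {d : G.Walk a b} {m : ℝ≥0}
    (hd : ∀ g ∈ d.edges, g ∉ F ∧ w g ≤ m) : faultWeight G w F s(a, b) ≤ d.length * m := by
  have hdF : ∀ g ∈ d.edges, g ∈ (G.deleteEdges (F : Set (Sym2 V))).edgeSet := fun g hg => by
    rw [SimpleGraph.edgeSet_deleteEdges]
    exact ⟨d.edges_subset_edgeSet hg, (hd g hg).1⟩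
  refine (wdist_le_walkWeight (d.transfer _ hdF)).trans ?_
  rw [walkWeight_transfer]
  exact walkWeight_le_length_mul fun g hg => ENNReal.coe_le_coe.2 (hd g hg).2

theorem faultWeight_le {e : Sym2 V} (he : e ∈ G.edgeSet) (heF : e ∉ F) :
    faultWeight G w F e ≤ w e := by
  induction e with
  | _ a b =>
    simpa using faultWeight_le_length_mul (d := (show G.Adj a b from he).toWalk) (m := w s(a, b))
      (F := F) (w := w) (by simpa using heF)

theorem IsGreedy.isEFTEmulator {t : ℝ≥0} (ht : 1 ≤ t) {rank : Sym2 V → ℕ}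
    (hH : IsGreedy G w f t rank H) : IsEFTEmulator G w f t H := by
  intro F _ hcard
  refine isEmulator_of_forall_adj (zero_lt_one.trans_le ht).ne' fun a b hab => ?_
  obtain ⟨habG, habF⟩ := SimpleGraph.deleteEdges_adj.1 hab
  by_cases he : s(a, b) ∈ H.edgeSet
  · calc _ ≤ faultWeight G w F s(a, b) := wdist_le_of_adj he
      _ ≤ w s(a, b) := faultWeight_le habG habF
      _ ≤ t * w s(a, b) := le_mul_of_one_le_left zero_le (ENNReal.one_le_coe_iff.2 ht)
  · by_contra! hlt
    exact he ((hH _).2 ⟨habG, F, hcard, habF, hlt.trans_le (wdist_le_wdist_lighterPart _ a b)⟩)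

section Detours

variable {t : ℕ} {rank : Sym2 V → ℕ} {x y : V}
  (hF : IsObstruction G (lighterPart H rank s(x, y)) w f t s(x, y) F)
  (hw : ∀ e e', rank e ≤ rank e' → w e ≤ w e') (hHG : H ≤ G) {p : H.Walk x y}
  (hp : ∀ g ∈ p.edges, rank g < rank s(x, y))

include hF hp in
theorem IsObstruction.lt_walkWeight :
    ((t : ℝ≥0) : ℝ≥0∞) * w s(x, y) < walkWeight (faultWeight G w F) p := by
  have hlight : ∀ g ∈ p.edges, g ∈ (lighterPart H rank s(x, y)).edgeSet := fun g hg => by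
    rw [lighterPart, SimpleGraph.edgeSet_fromEdgeSet]
    have hgH := p.edges_subset_edgeSet hg
    exact ⟨⟨hgH, hp g hg⟩, H.not_isDiag_of_mem_edgeSet hgH⟩
  refine hF.lt_emulatorWeight.trans_le ((wdist_le_walkWeight (p.transfer _ hlight)).trans_eq ?_)
  exact walkWeight_transfer p hlight

include hF hw hHG hp in
theorem IsObstruction.exists_mem (hlen : p.length ≤ t) : ∃ g ∈ p.edges, g ∈ F := by
  by_contra! hpF
  refine (hF.lt_walkWeight hp).not_ge ((walkWeight_le_length_mul fun g hg => ?_).trans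
    (mul_le_mul_left (by exact_mod_cast hlen : (p.length : ℝ≥0∞) ≤ ((t : ℝ≥0) : ℝ≥0∞)) _))
  exact (faultWeight_le (SimpleGraph.edgeSet_mono hHG (p.edges_subset_edgeSet hg))
    (hpF g hg)).trans (ENNReal.coe_le_coe.2 (hw _ _ (hp g hg).le))

include hw hHG hp in
theorem faultWeight_le_of_unique_fault (hxy : G.Adj x y) (hxyF : s(x, y) ∉ F) (htrail : p.IsTrail)
    {e : Sym2 V} (he : e ∈ p.edges) (hunique : ∀ g ∈ p.edges, g ∈ F → g = e) :
    faultWeight G w F e ≤ p.length * w s(x, y) := by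
  obtain ⟨a, b, d, rfl, hlen, hd⟩ := exists_walk_avoiding_edge (p := p.mapLe hHG)
    ((htrail.mapLe hHG))
    (by rwa [SimpleGraph.Walk.edges_mapLe_eq_edges]) hxy.toWalk
  rw [SimpleGraph.Walk.edges_mapLe_eq_edges] at hd
  have hdlen : d.length = p.length := by simpa using hlen
  rw [← hdlen]
  refine faultWeight_le_length_mul fun g hg => ?_
  rcases hd g hg with hg | ⟨hg, hne⟩
  · obtain rfl : g = s(x, y) := by simpa using hg
    exact ⟨hxyF, le_rfl⟩
  · exact ⟨fun hgF => hne (hunique g hg hgF), hw _ _ (hp g hg).le⟩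

include hF hw hHG hp in
/-- If a trail contains a single fault, then the ends of this fault are joined by a short detour in
`G \ F` along the rest of the trail and the edge `xy`, so that the trail is still light. -/
theorem IsObstruction.nontrivial_of_isTrail (hxy : G.Adj x y) (htrail : p.IsTrail)
    (hlen : 2 * p.length ≤ t + 1) : {g | g ∈ p.edges ∧ g ∈ F}.Nontrivial := by
  classical
  obtain ⟨e, he, heF⟩ := hF.exists_mem hw hHG hp (by omega)
  by_contra hsub
  have hunique : ∀ g ∈ p.edges, g ∈ F → g = e := fun g hg hgF =>
    Set.not_nontrivial_iff.1 hsub ⟨hg, hgF⟩ ⟨he, heF⟩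
  have hrest : ((p.edges.erase e).map (faultWeight G w F)).sum ≤
      ((p.length - 1 : ℕ) : ℝ≥0∞) * w s(x, y) := by
    have hle : ∀ g ∈ p.edges.erase e, faultWeight G w F g ≤ w s(x, y) := fun g hg => by
      obtain ⟨hne, hg⟩ := htrail.edges_nodup.mem_erase_iff.1 hg
      exact (faultWeight_le (SimpleGraph.edgeSet_mono hHG (p.edges_subset_edgeSet hg))
        fun hgF => hne (hunique g hg hgF)).trans (ENNReal.coe_le_coe.2 (hw _ _ (hp g hg).le))
    simpa [List.length_erase_of_mem he, nsmul_eq_mul] using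
      List.sum_le_card_nsmul _ _ (List.forall_mem_map.2 hle)
  refine (hF.lt_walkWeight hp).not_ge ?_
  calc walkWeight (faultWeight G w F) p
      = faultWeight G w F e + ((p.edges.erase e).map (faultWeight G w F)).sum :=
        (List.sum_map_erase _ he).symm
    _ ≤ p.length * w s(x, y) + ((p.length - 1 : ℕ) : ℝ≥0∞) * w s(x, y) :=
      add_le_add (faultWeight_le_of_unique_fault hw hHG hp hxy hF.notMem htrail he hunique) hrest
    _ = ((p.length + (p.length - 1) : ℕ) : ℝ≥0∞) * w s(x, y) := by rw [Nat.cast_add, add_mul]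
    _ ≤ ((t : ℝ≥0) : ℝ≥0∞) * w s(x, y) := by
      gcongr
      exact_mod_cast (by omega : p.length + (p.length - 1) ≤ t)

end Detours

theorem IsGreedy.nonempty_blockingSystem {t : ℕ} {rank : Sym2 V → ℕ}
    (hrank : Function.Injective rank) (hw : ∀ e e', rank e ≤ rank e' → w e ≤ w e')
    (hH : IsGreedy G w f t rank H) : Nonempty (BlockingSystem H t f) := by
  classical
  have hHG : H ≤ G := SimpleGraph.edgeSet_subset_edgeSet.1 fun e he => ((hH e).1 he).1
  have hfaults : ∀ e, ∃ F : Finset (Sym2 V), F.card ≤ f ∧ e ∉ F ∧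
      (e ∈ H.edgeSet → IsObstruction G (lighterPart H rank e) w f t e F) := fun e => by
    by_cases he : e ∈ H.edgeSet
    · obtain ⟨-, F, hF⟩ := (hH e).1 he
      exact ⟨F, hF.card_le, hF.notMem, fun _ => hF⟩
    · exact ⟨∅, Nat.zero_le f, Finset.notMem_empty e, fun h => absurd h he⟩
  choose faults hcard hnotMem hobs using hfaults
  refine ⟨⟨rank, hrank.injOn, faults, hcard, hnotMem, fun hxy p hp hlen =>
    (hobs _ hxy).exists_mem hw hHG hp hlen, fun hxy p hp hlen => ?_⟩⟩
  have hbypass : p.bypass.edges ⊆ p.edges := p.edges_bypass_subset_edges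
  refine ((hobs _ hxy).nontrivial_of_isTrail hw hHG (fun g hg => hp g (hbypass hg)) (hHG hxy)
    p.bypass_isPath.isTrail ?_).mono fun g hg => ⟨hbypass hg.1, hg.2⟩
  have := p.length_bypass_le_length
  omega

end Greedy

/-! ### Reduction to bounded degree -/

section Split

universe v

variable {V : Type u} {W : Type v} {X : SimpleGraph V} {Y : SimpleGraph W} {t f : ℕ}

/-- The pullback of a blocking system along a homomorphism that is injective on edges: the faults of
an edge are the preimages of the faults of its image. -/
noncomputable def BlockingSystem.comap (c : BlockingSystem X t f) (φ : Y →g X)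
    (hφ : Set.InjOn (Sym2.map φ) Y.edgeSet) : BlockingSystem Y t f :=
  have hedge : ∀ e ∈ Y.edgeSet, Sym2.map φ e ∈ X.edgeSet := fun _ he => φ.map_mem_edgeSet he
  let P (e : Sym2 W) : Set (Sym2 W) := {g ∈ Y.edgeSet | Sym2.map φ g ∈ c.faults (Sym2.map φ e)}
  have hP : ∀ e, (P e).Finite := fun e =>
    .of_injOn (fun _ hg => hg.2) (hφ.mono fun _ hg => hg.1) (c.faults (Sym2.map φ e)).finite_toSet
  have hlight : ∀ {x y} (p : Y.Walk x y),
      (∀ g ∈ p.edges, c.rank (Sym2.map φ g) < c.rank (Sym2.map φ s(x, y))) →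
        ∀ g ∈ (p.map φ).edges, c.rank g < c.rank s(φ x, φ y) := fun p hp => by
    simpa only [SimpleGraph.Walk.edges_map, List.forall_mem_map, Sym2.map_mk] using hp
  { rank := fun e => c.rank (Sym2.map φ e)
    rank_injOn := fun e he e' he' h =>
      hφ he he' (c.rank_injOn (hedge e he) (hedge e' he') h)
    faults := fun e => (hP e).toFinset
    card_faults_le := fun e => by
      refine (Finset.card_le_card_of_injOn (Sym2.map φ) ?_ ?_).trans
        (c.card_faults_le (Sym2.map φ e))
      · exact fun g hg => ((hP e).mem_toFinset.1 hg).2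
      · exact hφ.mono fun g hg => ((hP e).mem_toFinset.1 hg).1
    notMem_faults := fun e he => c.notMem_faults _ ((hP e).mem_toFinset.1 he).2
    exists_mem_faults := fun hxy p hp hlen => by
      obtain ⟨g, hg, hgF⟩ :=
        c.exists_mem_faults (φ.map_adj hxy) (p.map φ) (hlight p hp) (by simpa using hlen)
      rw [SimpleGraph.Walk.edges_map] at hg
      obtain ⟨g, hgp, rfl⟩ := List.mem_map.1 hg
      exact ⟨g, hgp, (hP _).mem_toFinset.2 ⟨p.edges_subset_edgeSet hgp, hgF⟩⟩
    nontrivial_faults := fun hxy p hp hlen => by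
      obtain ⟨g, ⟨hg, hgF⟩, g', ⟨hg', hgF'⟩, hne⟩ :=
        c.nontrivial_faults (φ.map_adj hxy) (p.map φ) (hlight p hp) (by simpa using hlen)
      rw [SimpleGraph.Walk.edges_map] at hg hg'
      obtain ⟨g, hgp, rfl⟩ := List.mem_map.1 hg
      obtain ⟨g', hgp', rfl⟩ := List.mem_map.1 hg'
      exact ⟨g, ⟨hgp, (hP _).mem_toFinset.2 ⟨p.edges_subset_edgeSet hgp, hgF⟩⟩,
        g', ⟨hgp', (hP _).mem_toFinset.2 ⟨p.edges_subset_edgeSet hgp', hgF'⟩⟩,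
        fun h => hne (congrArg _ h)⟩ }

/-- The graph that arises from `X` by splitting each vertex `a` into copies indexed by `ι a`, where
`part a b` is the copy of `a` that keeps the edge to `b`. -/
def splitGraph (X : SimpleGraph V) {ι : V → Type v} (part : ∀ a : V, V → ι a) :
    SimpleGraph (Σ a, ι a) where
  Adj x y := X.Adj x.1 y.1 ∧ x.2 = part x.1 y.1 ∧ y.2 = part y.1 x.1
  symm := ⟨fun _ _ h => ⟨h.1.symm, h.2.2, h.2.1⟩⟩
  loopless := ⟨fun _ h => h.1.ne rfl⟩

variable {ι : V → Type v} {part : ∀ a : V, V → ι a}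

variable (X part) in
/-- The projection of the split graph, which sends each copy of a vertex to this vertex. -/
def splitHom : splitGraph X part →g X := ⟨Sigma.fst, fun h => h.1⟩

theorem injOn_map_splitHom :
    Set.InjOn (Sym2.map (splitHom X part)) (splitGraph X part).edgeSet := by
  rintro ⟨⟨a, i⟩, ⟨b, j⟩⟩ ⟨-, hi, hj⟩ ⟨⟨a', i'⟩, ⟨b', j'⟩⟩ ⟨-, hi', hj'⟩ h
  obtain rfl : i = part a b := hi
  obtain rfl : j = part b a := hj
  obtain rfl : i' = part a' b' := hi'
  obtain rfl : j' = part b' a' := hj'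
  obtain ⟨rfl, rfl⟩ | ⟨rfl, rfl⟩ : a = a' ∧ b = b' ∨ a = b' ∧ b = a' := Sym2.eq_iff.1 h
  · rfl
  · exact Sym2.eq_swap

theorem edgeSet_subset_image_map_splitHom :
    X.edgeSet ⊆ Sym2.map (splitHom X part) '' (splitGraph X part).edgeSet := by
  rintro ⟨a, b⟩ hab
  exact ⟨s(⟨a, part a b⟩, ⟨b, part b a⟩), ⟨hab, rfl, rfl⟩, rfl⟩

theorem ncard_edgeSet_le_splitGraph [Finite (Σ a, ι a)] :
    X.edgeSet.ncard ≤ (splitGraph X part).edgeSet.ncard :=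
  (Set.ncard_le_ncard edgeSet_subset_image_map_splitHom (Set.toFinite _)).trans
    (Set.ncard_image_le (Set.toFinite _))

theorem ncard_neighborSet_splitGraph_le [Finite V] (a : V) (i : ι a) :
    ((splitGraph X part).neighborSet ⟨a, i⟩).ncard ≤
      {b ∈ X.neighborSet a | part a b = i}.ncard := by
  refine Set.ncard_le_ncard_of_injOn Sigma.fst (fun y hy => ⟨hy.1, hy.2.1.symm⟩) ?_
    (Set.toFinite _)
  rintro ⟨b, j⟩ ⟨-, -, hj⟩ ⟨b', j'⟩ ⟨-, -, hj'⟩ (rfl : b = b')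
  exact congrArg _ (hj.trans hj'.symm)

theorem BlockingSystem.exists_bounded_degree [Fintype V] (c : BlockingSystem X t f) {Δ : ℕ}
    (hΔ : 0 < Δ) : ∃ (W : Type u) (_ : Fintype W) (Y : SimpleGraph W),
      Nonempty (BlockingSystem Y t f) ∧ (∀ v, (Y.neighborSet v).ncard ≤ Δ) ∧
      X.edgeSet.ncard ≤ Y.edgeSet.ncard ∧
      Fintype.card W * Δ ≤ Fintype.card V * Δ + 2 * X.edgeSet.ncard := by
  classical
  choose k hk part hpart using fun a => exists_partition_card_le (X.neighborFinset a) hΔ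
  refine ⟨Σ a, Fin (k a), inferInstance, splitGraph X part,
    ⟨c.comap (splitHom X part) injOn_map_splitHom⟩, ?_, ncard_edgeSet_le_splitGraph, ?_⟩
  · rintro ⟨a, i⟩
    calc ((splitGraph X part).neighborSet ⟨a, i⟩).ncard
        ≤ {b ∈ X.neighborSet a | part a b = i}.ncard :=
          ncard_neighborSet_splitGraph_le (part := part) a i
      _ = {b ∈ X.neighborFinset a | part a b = i}.card := by
        simp only [← Set.ncard_coe_finset, Finset.coe_filter, SimpleGraph.mem_neighborFinset,
          SimpleGraph.mem_neighborSet]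
      _ ≤ Δ := hpart a i
  · have hdeg : ∑ a, (X.neighborFinset a).card = 2 * X.edgeSet.ncard := by
      rw [← SimpleGraph.coe_edgeFinset, Set.ncard_coe_finset]
      exact X.sum_degrees_eq_twice_card_edges
    calc Fintype.card (Σ a, Fin (k a)) * Δ = ∑ a, k a * Δ := by
          simp only [Fintype.card_sigma, Fintype.card_fin, Finset.sum_mul]
      _ ≤ ∑ a, (Δ + (X.neighborFinset a).card) := Finset.sum_le_sum fun a _ => hk a
      _ = Fintype.card V * Δ + 2 * X.edgeSet.ncard := by
          rw [Finset.sum_add_distrib, hdeg, Finset.sum_const, smul_eq_mul, Finset.card_univ]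

end Split

namespace BlockingSystem

theorem two_mul_collisionBound_le {f c m r : ℕ} (hr : 1 ≤ r) (hm : 16 * c ^ (2 * r) * (f + 1) ≤ m)
    (hm' : 4 * (r + 1) ^ 2 * (2 * (r + 1)) ^ (2 * r) * c ^ (2 * r) * (f + 1) ^ (2 * r + 1) ≤ m ^ 2)
    (hc : 0 < c) : 2 * collisionBound f (c * m) r ≤ m ^ (2 * r) := by
  obtain ⟨s, rfl⟩ := Nat.exists_eq_add_of_le' hr
  have hsingle : 4 * (2 * (f * (2 * (c * m) ^ s) * (c * m) ^ (s + 1))) ≤ m ^ (2 * (s + 1)) :=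
    calc _ = 16 * c ^ (2 * s + 1) * f * m ^ (2 * s + 1) := by ring
      _ ≤ 16 * c ^ (2 * (s + 1)) * (f + 1) * m ^ (2 * s + 1) := by gcongr <;> omega
      _ ≤ m * m ^ (2 * s + 1) := by gcongr
      _ = m ^ (2 * (s + 1)) := by ring
  have hsquare : 4 * (f * ((s + 1 + 1) * (2 * (f + 1) * (s + 1 + 1)) ^ (s + 1) * (c * m) ^ s) ^ 2) ≤
      m ^ (2 * (s + 1)) :=
    calc _ = 4 * (s + 1 + 1) ^ 2 * (2 * (s + 1 + 1)) ^ (2 * (s + 1)) * c ^ (2 * s) *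
          (f * (f + 1) ^ (2 * (s + 1))) * m ^ (2 * s) := by
          rw [mul_right_comm 2 (f + 1), mul_pow _ (f + 1)]
          ring
      _ ≤ 4 * (s + 1 + 1) ^ 2 * (2 * (s + 1 + 1)) ^ (2 * (s + 1)) * c ^ (2 * (s + 1)) *
          ((f + 1) * (f + 1) ^ (2 * (s + 1))) * m ^ (2 * s) := by gcongr <;> omega
      _ ≤ m ^ 2 * m ^ (2 * s) := by
          rw [← pow_succ']
          gcongr
      _ = m ^ (2 * (s + 1)) := by ring
  simp only [collisionBound, Nat.add_sub_cancel]
  omega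

theorem add_mul_lt_two_mul_pow {f r : ℕ} (hr : 1 ≤ r) :
    f + (r - 1) * ((2 * f + 1) * (f + 1)) < 2 * r * (f + 1) ^ r := by
  obtain ⟨s, rfl⟩ := Nat.exists_eq_add_of_le' hr
  rcases Nat.eq_zero_or_pos s with rfl | hs
  · rw [zero_add, pow_one]
    omega
  calc f + s * ((2 * f + 1) * (f + 1)) < 2 * (s + 1) * (f + 1) ^ 2 := by nlinarith
    _ ≤ 2 * (s + 1) * (f + 1) ^ (s + 1) := by gcongr <;> omega

theorem exists_threshold {r : ℕ} (hr : 1 ≤ r) : ∃ A, ∀ {f m : ℕ},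
    A * (f + 1) ^ (2 * r + 1) ≤ m ^ 2 →
      2 * collisionBound f (41 * r * m) r ≤ m ^ (2 * r) ∧
        f + (r - 1) * ((2 * f + 1) * (f + 1)) < m := by
  set c := 41 * r
  refine ⟨(16 * c ^ (2 * r)) ^ 2 + 4 * (r + 1) ^ 2 * (2 * (r + 1)) ^ (2 * r) * c ^ (2 * r),
    fun {f m} hA => ?_⟩
  rw [add_mul] at hA
  have hpow : ∀ i, i ≤ r → 16 * c ^ (2 * r) * (f + 1) ^ i ≤ m := fun i hi => by
    refine (Nat.pow_le_pow_iff_left two_ne_zero).1 ?_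
    calc (16 * c ^ (2 * r) * (f + 1) ^ i) ^ 2
        = (16 * c ^ (2 * r)) ^ 2 * (f + 1) ^ (2 * i) := by ring
      _ ≤ (16 * c ^ (2 * r)) ^ 2 * (f + 1) ^ (2 * r + 1) := by gcongr <;> omega
      _ ≤ m ^ 2 := (Nat.le_add_right _ _).trans hA
  refine ⟨two_mul_collisionBound_le hr (by simpa using hpow 1 hr)
    ((Nat.le_add_left _ _).trans hA) (by omega), (add_mul_lt_two_mul_pow hr).trans_le ?_⟩
  have hrc : r ≤ c ^ (2 * r) := (by omega : r ≤ c).trans (Nat.le_self_pow (by omega) c)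
  exact le_trans (by gcongr; omega) (hpow r le_rfl)

variable {V : Type u} [Fintype V] {X : SimpleGraph V} {t f r m : ℕ}

theorem pow_le_card_of_threshold (c : BlockingSystem X t f) (hr : 1 ≤ r) (ht : 4 * r + 1 ≤ t)
    (hm : m = X.edgeSet.ncard / (40 * r * Fintype.card V))
    (hM : 2 * collisionBound f (41 * r * m) r ≤ m ^ (2 * r))
    (hδ : f + (r - 1) * ((2 * f + 1) * (f + 1)) < m) : m ^ (2 * r + 1) ≤ 5 * Fintype.card V := by
  set n := Fintype.card V
  have hn : 0 < n := Nat.pos_of_ne_zero fun h => by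
    rw [h, mul_zero, Nat.div_zero] at hm
    omega
  have hrn : 0 < 40 * r * n := by positivity
  have hrm : 0 < r * m := Nat.mul_pos hr (by omega)
  have hEm : 40 * (r * m * n) ≤ X.edgeSet.ncard := by
    have := Nat.mul_div_le X.edgeSet.ncard (40 * r * n)
    rw [← hm] at this
    linarith
  have hmE : X.edgeSet.ncard ≤ 80 * (r * m * n) := by
    have := Nat.lt_mul_div_succ X.edgeSet.ncard hrn
    rw [← hm] at this
    nlinarith [Nat.mul_le_mul_left (r * n) (by omega : 1 ≤ m)]
  obtain ⟨W, _, Y, ⟨d⟩, hdeg, hXY, hW⟩ := c.exists_bounded_degree (Δ := 40 * (r * m)) (by omega)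
  set N := Fintype.card W
  have hN : N ≤ 5 * n := by
    refine Nat.le_of_mul_le_mul_right (hW.trans ?_) (by omega : 0 < 40 * (r * m))
    linarith
  set L := (d.level (2 * m) r).card
  have hL : 10 * (r * m * n) ≤ L := by
    have hlevel : Y.edgeSet.ncard ≤ 2 * (L + r * (N * (2 * m))) := d.card_edgeSet_le_level _ _
    nlinarith [Nat.mul_le_mul_left (r * m) hN]
  have hcount : L * m ^ (2 * r) ≤ N ^ 2 + L * collisionBound f (41 * r * m) r :=
    d.card_level_mul_pow_le (fun v => (hdeg v).trans_lt (by linarith)) ht (by omega)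
  have hLN : L * m ^ (2 * r) ≤ 2 * N ^ 2 := by nlinarith [Nat.mul_le_mul_left L hM]
  refine Nat.le_of_mul_le_mul_left ?_ (by omega : 0 < 10 * n)
  calc 10 * n * m ^ (2 * r + 1) = 10 * (1 * m * n) * m ^ (2 * r) := by ring
    _ ≤ 10 * (r * m * n) * m ^ (2 * r) := by gcongr
    _ ≤ L * m ^ (2 * r) := by gcongr
    _ ≤ 2 * N ^ 2 := hLN
    _ ≤ 2 * (5 * n) ^ 2 := by gcongr
    _ = 10 * n * (5 * n) := by ring

theorem exists_density_bound (hr : 1 ≤ r) : ∃ A, ∀ {V : Type u} [Fintype V] {X : SimpleGraph V}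
    {t f : ℕ}, 4 * r + 1 ≤ t → BlockingSystem X t f →
      ∀ m, m = X.edgeSet.ncard / (40 * r * Fintype.card V) →
        m ^ 2 ≤ A * (f + 1) ^ (2 * r + 1) ∨ m ^ (2 * r + 1) ≤ 5 * Fintype.card V := by
  obtain ⟨A, hA⟩ := exists_threshold hr
  refine ⟨A, fun ht c m hm => (le_total _ _).imp_right fun h => ?_⟩
  exact c.pow_le_card_of_threshold hr ht hm (hA h).1 (hA h).2

end BlockingSystem

/-! ### Bounds in real powers -/

theorem le_rpow_mul_rpow_of_pow_le {a A b : ℝ} {p q : ℕ} (ha : 0 ≤ a) (hA : 0 ≤ A) (hb : 0 ≤ b)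
    (hp : p ≠ 0) (h : a ^ p ≤ A * b ^ q) : a ≤ A ^ (1 / p : ℝ) * b ^ (q / p : ℝ) :=
  calc a = (a ^ p) ^ (1 / p : ℝ) := by rw [one_div, Real.pow_rpow_inv_natCast ha hp]
    _ ≤ (A * b ^ q) ^ (1 / p : ℝ) := by gcongr
    _ = A ^ (1 / p : ℝ) * b ^ (q / p : ℝ) := by
      rw [Real.mul_rpow hA (by positivity), ← Real.rpow_natCast_mul hb, mul_one_div]

theorem le_rpow_add_rpow_of_pow_le {m A B f n k : ℕ} (hk : k ≠ 0)
    (h : m ^ 2 ≤ A * (f + 1) ^ k ∨ m ^ k ≤ B * n) :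
    (m : ℝ) ≤ (A : ℝ) ^ (1 / 2 : ℝ) * ((f : ℝ) + 1) ^ (k / 2 : ℝ) +
      (B : ℝ) ^ (1 / k : ℝ) * (n : ℝ) ^ (1 / k : ℝ) := by
  rcases h with h | h
  · have hm := le_rpow_mul_rpow_of_pow_le (a := m) (A := A) (b := f + 1) (q := k)
      (by positivity) (by positivity) (by positivity) two_ne_zero (by exact_mod_cast h)
    rw [Nat.cast_two] at hm
    exact le_add_of_le_of_nonneg hm (by positivity)
  · have hm := le_rpow_mul_rpow_of_pow_le (a := m) (A := B) (b := n) (p := k) (q := 1)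
      (by positivity) (by positivity) (by positivity) hk (by rw [pow_one]; exact_mod_cast h)
    rw [Nat.cast_one] at hm
    exact le_add_of_nonneg_of_le (by positivity) hm

variable {V : Type u} [Fintype V]

theorem ncard_edgeSet_le_sq (X : SimpleGraph V) : X.edgeSet.ncard ≤ Fintype.card V ^ 2 := by
  classical
  rw [← SimpleGraph.coe_edgeFinset, Set.ncard_coe_finset]
  exact SimpleGraph.card_edgeFinset_le_card_choose_two.trans (Nat.choose_le_pow _ _)

theorem ncard_edgeSet_le_mul_div_add_one (X : SimpleGraph V) {c : ℕ} (hc : 0 < c) :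
    X.edgeSet.ncard ≤ c * Fintype.card V * (X.edgeSet.ncard / (c * Fintype.card V) + 1) := by
  rcases Nat.eq_zero_or_pos (Fintype.card V) with hn | hn
  · exact (ncard_edgeSet_le_sq X).trans (by simp [hn])
  · exact (Nat.lt_mul_div_succ _ (Nat.mul_pos hc hn)).le

theorem BlockingSystem.exists_ncard_edgeSet_le {k : ℕ} (hk : Odd k) :
    ∃ K : ℝ, ∀ {V : Type u} [Fintype V] {X : SimpleGraph V} {f : ℕ},
      BlockingSystem X (2 * k - 1) f → (X.edgeSet.ncard : ℝ) ≤
        K * ((Fintype.card V : ℝ) ^ (1 + 1 / k : ℝ) +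
          ((f : ℝ) + 1) ^ (k / 2 : ℝ) * Fintype.card V) := by
  obtain ⟨r, rfl⟩ := hk
  rcases Nat.eq_zero_or_pos r with rfl | hr
  · refine ⟨1, fun {V _ X f} _ => ?_⟩
    have hsq : (X.edgeSet.ncard : ℝ) ≤ (Fintype.card V : ℝ) ^ 2 := by
      exact_mod_cast ncard_edgeSet_le_sq X
    have hexp : (1 + 1 / (2 * 0 + 1 : ℕ) : ℝ) = (2 : ℕ) := by norm_num
    rw [one_mul, hexp, Real.rpow_natCast]
    exact hsq.trans (le_add_of_nonneg_right (by positivity))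
  obtain ⟨A, hA⟩ := exists_density_bound.{u} hr
  set k := 2 * r + 1
  have hk0 : k ≠ 0 := Nat.succ_ne_zero _
  refine ⟨40 * r * ((A : ℝ) ^ (1 / 2 : ℝ) + 1 + 5 ^ (1 / k : ℝ)), fun {V _ X f} c => ?_⟩
  set n := Fintype.card V
  obtain ⟨m, hm⟩ : ∃ m, m = X.edgeSet.ncard / (40 * r * n) := ⟨_, rfl⟩
  have hE : (X.edgeSet.ncard : ℝ) ≤ 40 * r * n * (m + 1) := by
    have := ncard_edgeSet_le_mul_div_add_one X (by omega : 0 < 40 * r)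
    rw [← hm] at this
    exact_mod_cast this
  set x := (n : ℝ) ^ (1 / k : ℝ)
  set y := ((f : ℝ) + 1) ^ (k / 2 : ℝ)
  have hy : 1 ≤ y := Real.one_le_rpow (by linarith [f.cast_nonneg (α := ℝ)]) (by positivity)
  have hmxy : (m : ℝ) ≤ (A : ℝ) ^ (1 / 2 : ℝ) * y + 5 ^ (1 / k : ℝ) * x := by
    simpa only [Nat.cast_ofNat] using le_rpow_add_rpow_of_pow_le hk0 (hA (by omega) c m hm)
  rw [Real.rpow_one_add' (by positivity) (by positivity)]
  calc (X.edgeSet.ncard : ℝ) ≤ 40 * r * n * (m + 1) := hE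
    _ ≤ 40 * r * n * (((A : ℝ) ^ (1 / 2 : ℝ) + 1 + 5 ^ (1 / k : ℝ)) * (x + y)) := by
      have : (0 : ℝ) ≤ (A : ℝ) ^ (1 / 2 : ℝ) * x + x + 5 ^ (1 / k : ℝ) * y := by positivity
      gcongr
      linarith
    _ = _ := by ring

end EFT

theorem mainTheorem3_general {k : ℕ} (hk : Odd k) :
    ∃ K : ℝ, ∀ (V : Type u) [Fintype V] (G : SimpleGraph V) (w : Sym2 V → ℝ≥0) (f : ℕ),
      ∃ H : SimpleGraph V, EFT.IsEFTEmulator G w f ((2 * k - 1 : ℕ) : ℝ≥0) H ∧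
        (H.edgeSet.ncard : ℝ) ≤ K * ((Fintype.card V : ℝ) ^ (1 + 1 / k : ℝ) +
          ((f : ℝ) + 1) ^ (k / 2 : ℝ) * Fintype.card V) := by
  obtain ⟨K, hK⟩ := EFT.BlockingSystem.exists_ncard_edgeSet_le.{u} hk
  refine ⟨K, fun V _ G w f => ?_⟩
  obtain ⟨rank, hrank, hw⟩ := EFT.exists_injective_rank w
  obtain ⟨H, hH⟩ := EFT.exists_isGreedy G w f ((2 * k - 1 : ℕ) : ℝ≥0) rank
  obtain ⟨c⟩ := hH.nonempty_blockingSystem hrank hw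
  have hk1 : 1 ≤ 2 * k - 1 := by have := hk.pos; omega
  exact ⟨H, hH.isEFTEmulator (by exact_mod_cast hk1), hK c⟩

theorem EFT.exists_isEFTEmulator_of_le_rpow {k : ℕ} (hk : Odd k) {α : ℝ} (hα : α ≤ 2 / (k : ℝ) ^ 2)
    (C : ℝ) : ∃ K : ℝ, ∀ (V : Type u) [Fintype V] (G : SimpleGraph V) (w : Sym2 V → ℝ≥0) (f : ℕ),
      (f : ℝ) ≤ C * (Fintype.card V : ℝ) ^ α →
        ∃ H : SimpleGraph V, EFT.IsEFTEmulator G w f ((2 * k - 1 : ℕ) : ℝ≥0) H ∧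
          (H.edgeSet.ncard : ℝ) ≤ K * (Fintype.card V : ℝ) ^ (1 + 1 / k : ℝ) := by
  obtain ⟨K, hK⟩ := mainTheorem3_general.{u} hk
  refine ⟨|K| * (1 + (|C| + 1) ^ (k / 2 : ℝ)), fun V _ G w f hf => ?_⟩
  obtain ⟨H, hGH, hE⟩ := hK V G w f
  refine ⟨H, hGH, hE.trans ?_⟩
  have hk0 : (0 : ℝ) < k := by exact_mod_cast hk.pos
  set n := Fintype.card V
  have hfn : ((f : ℝ) + 1) ^ (k / 2 : ℝ) * n ≤
      (|C| + 1) ^ (k / 2 : ℝ) * (n : ℝ) ^ (1 + 1 / k : ℝ) := by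
    rcases Nat.eq_zero_or_pos n with hn | hn
    · rw [hn, Nat.cast_zero, mul_zero]
      positivity
    have hn1 : (1 : ℝ) ≤ n := by exact_mod_cast hn
    set y := (n : ℝ) ^ (2 / (k : ℝ) ^ 2)
    have hy1 : 1 ≤ y := Real.one_le_rpow hn1 (by positivity)
    have hfy : (f : ℝ) ≤ |C| * y := hf.trans (mul_le_mul (le_abs_self C)
      (Real.rpow_le_rpow_of_exponent_le hn1 hα) (by positivity) (abs_nonneg C))
    calc ((f : ℝ) + 1) ^ (k / 2 : ℝ) * n ≤ ((|C| + 1) * y) ^ (k / 2 : ℝ) * n := by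
          gcongr
          linarith
      _ = (|C| + 1) ^ (k / 2 : ℝ) * (n : ℝ) ^ (1 + 1 / k : ℝ) := by
          rw [Real.mul_rpow (by positivity) (by positivity), ← Real.rpow_mul (by positivity),
            Real.rpow_one_add' (by positivity) (by positivity), mul_assoc, mul_comm (n : ℝ)]
          congr 3
          field_simp
  calc K * ((n : ℝ) ^ (1 + 1 / k : ℝ) + ((f : ℝ) + 1) ^ (k / 2 : ℝ) * n)
      ≤ |K| * ((n : ℝ) ^ (1 + 1 / k : ℝ) +
          (|C| + 1) ^ (k / 2 : ℝ) * (n : ℝ) ^ (1 + 1 / k : ℝ)) := by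
        gcongr
        exact le_abs_self K
    _ = |K| * (1 + (|C| + 1) ^ (k / 2 : ℝ)) * (n : ℝ) ^ (1 + 1 / k : ℝ) := by ring

theorem mainTheorem3 :
    (∀ C : ℝ, ∃ K : ℝ, ∀ (V : Type u) [Fintype V] (G : SimpleGraph V) (w : Sym2 V → ℝ≥0) (f : ℕ),
      (f : ℝ) ≤ C * (Fintype.card V : ℝ) ^ (2 / 9 : ℝ) →
        ∃ H : SimpleGraph V, EFT.IsEFTEmulator G w f 5 H ∧
          (H.edgeSet.ncard : ℝ) ≤ K * (Fintype.card V : ℝ) ^ (4 / 3 : ℝ)) ∧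
    (∀ k : ℕ, Odd k → ∀ C : ℝ, ∃ K : ℝ,
      ∀ (V : Type u) [Fintype V] (G : SimpleGraph V) (w : Sym2 V → ℝ≥0) (f : ℕ),
        (f : ℝ) ≤ C * (Fintype.card V : ℝ) ^ (2 / ((k : ℝ) * ((k : ℝ) + 1))) →
          ∃ H : SimpleGraph V, EFT.IsEFTEmulator G w f ((2 * k - 1 : ℕ) : ℝ≥0) H ∧
            (H.edgeSet.ncard : ℝ) ≤ K * (Fintype.card V : ℝ) ^ (1 + 1 / (k : ℝ))) := by
  refine ⟨fun C => ?_, fun k hk C => EFT.exists_isEFTEmulator_of_le_rpow hk ?_ C⟩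
  · have h5 : ((2 * 3 - 1 : ℕ) : ℝ≥0) = 5 := by norm_num
    have h43 : (1 + 1 / (3 : ℕ) : ℝ) = 4 / 3 := by norm_num
    simpa only [h5, h43] using EFT.exists_isEFTEmulator_of_le_rpow (k := 3) (by decide)
      (by norm_num : (2 / 9 : ℝ) ≤ 2 / (3 : ℕ) ^ 2) C
  · have hk0 : (0 : ℝ) < k := by exact_mod_cast hk.pos
    rw [sq]
    gcongr
    linarith
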